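/- Let $E_4$ be a simple (embedded) polygonal chain in $\mathbb R^3$ with vertices $p_0,\dots,p_4$ and edges $e_k=[p_{k-1},p_k]$, $k=1,\dots,4$. For a unit vector $\xi$ let $(E_4)_\xi$ be the orthogonal projection of $E_4$ onto a plane with normal vector $\xi$; when it is generic, it is a knotoid diagram (over/under taken from the height along $\xi$). The probability of a property of $(E_4)_\xi$ is the area of the set of those $\xi\in S^2$ for which $(E_4)_\xi$ is generic and has the property, divided by the area $4\pi$ of $S^2$. Knotoids are considered on $S^2$, and $k2.1$ is the knotoid with the two-crossing diagram whose crossings $a,b$ have equal signs and are passed in the order $a$ over, $b$ under, $a$ under, $b$ over, up to mirror images. Let * $B(i)$: $(E_4)_\xi$ has exactly two crossings, of $e_1$ with $e_3$ and of $e_1$ with $e_4$, they have equal signs, and $e_1$ passes first through its crossing with $e_3$; * $B(ii)$: $(E_4)_\xi$ has exactly two crossings, of $e_2$ with $e_4$ and of $e_1$ with $e_4$, they have equal signs, and $e_4$ passes last through its crossing with $e_2$. Put $r_{ij}=p_i-p_j$ and let $\widehat{x}=x/\|x\|$ (with $\widehat 0=0$). Put $$n_1=\widehat{r_{02}\times r_{03}},\quad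 n_2=\widehat{r_{03}\times r_{13}},\quad n_3=\widehat{r_{13}\times r_{12}},\quad n_4=\widehat{r_{12}\times r_{02}},$$ $$u_2=\widehat{r_{04}\times r_{14}},\qquad v_2=\widehat{r_{14}\times r_{24}},\qquad v_3=\widehat{r_{24}\times r_{23}},$$ let $\varepsilon_{1,j}\in\{-1,0,1\}$ be the sign of $\big((p_1-p_0)\times(p_j-p_{j-1})\big)\cdot(p_0-p_{j-1})$ for $j=3,4$ (which is the sign of the crossing of $e_1$ and $e_j$ in every projection in which they cross), and let $$w=(u_2\times(-n_2))\cdot(u_2\times n_4),\quad w_0=(v_3\times(-n_1))\cdot(v_3\times n_3),\quad c_{4,1}=\big((p_1-p_4)\cdot n_1\big)\,\varepsilon_{1,3}.$$ For vectors $w_1,\dots,w_k$ let $\mathrm{Area}(w_1,\dots,w_k)$ be the area of the spherical polygon $\{x\in S^2: x\cdot w_i>0 \text{ for all } i\}$ bounded by the great circles with inward normal vectors $w_i$. Then the events below are measurable up to null sets, and $$P\big(K((E_4)_\xi)=k2.1\big)=P(B(i))+P(B(ii)),$$ where $$P(B(i))=\begin{cases}0, & \text{unless } \varepsilon_{1,3}=\varepsilon_{1,4},\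 w<0 \text{ and } w_0<0,\\[2pt] \frac1{2\pi}\mathrm{Area}(v_3,-v_2,-u_2), & \text{if } \varepsilon_{1,3}=\varepsilon_{1,4},\ w<0,\ w_0<0,\ c_{4,1}\le 0,\\[2pt] \frac1{2\pi}\mathrm{Area}(v_3,-v_2,n_1,-u_2), & \text{if } \varepsilon_{1,3}=\varepsilon_{1,4},\ w<0,\ w_0<0,\ c_{4,1}\ge 0\end{cases}$$ (both expressions being valid if $c_{4,1}=0$), and $P(B(ii))$ for $E_4$ equals $P(B(i))$ for the chain $p_4,p_3,p_2,p_1,p_0$ with reversed orientation. -/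

import Mathlib

/-- Euclidean 3-space. -/
abbrev E3 : Type := EuclideanSpace ℝ (Fin 3)

noncomputable section

/-- The cross product on `E3`. -/
def cross (a b : E3) : E3 := WithLp.toLp 2 (crossProduct a.ofLp b.ofLp)

/-! ### Signed Gauss codes of knotoid diagrams on the sphere -/

/-- A signed Gauss code: the successive passes `(a, o, s)` of an oriented open arc through the
crossings of its diagram, where `a` names the crossing, `o` says whether the arc passes over it
(`true`) or under it (`false`), and `s` is the sign of the crossing (`true` for `+`). -/
abbrev GaussCode : Type := List (ℕ × Bool × Bool)

namespace GaussCode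

/-- Every crossing is passed exactly twice, once over and once under, with one and the same sign. -/
def IsWellFormed (c : GaussCode) : Prop :=
  c.Nodup ∧ ∀ a o s, (a, o, s) ∈ c → (a, !o, s) ∈ c ∧ ∀ o', (a, o', !s) ∉ c

/-- The arc is cut by its `c.length` passes into the edges `0, …, c.length` of the diagram; edge `k`
runs from pass number `k - 1` to pass number `k`. A dart `(k, true)` (resp. `(k, false)`) is the edge
`k` traversed along (resp. against) the orientation of the arc. `nextDart` walks along
the boundary of the face to the left of a dart: it turns left at crossings and turns back at the two
endpoints of the arc. The other strand crosses the strand of the pass `(a, o, s)` from right to left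
exactly if `o = s`. -/
def nextDart (c : GaussCode) : ℕ × Bool → ℕ × Bool
  | (k, true) =>
    match getElem? c k with
    | none => (k, false)
    | some (a, o, s) =>
      if o = s then (c.idxOf (a, !o, s) + 1, true) else (c.idxOf (a, !o, s), false)
  | (0, false) => (0, true)
  | (k + 1, false) =>
    match getElem? c k with
    | none => (k + 1, true)
    | some (a, o, s) =>
      if o = s then (c.idxOf (a, !o, s), false) else (c.idxOf (a, !o, s) + 1, true)

/-- The number of faces of the closed oriented surface in which the diagram with code `c` is
cellularly embedded: the orbits of `nextDart` on the darts. -/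
def faceCount (c : GaussCode) : ℕ :=
  Nat.card (Quot fun d e : {d : ℕ × Bool // d.1 ≤ c.length} => nextDart c d.1 = e.1)

/-- `c` is the code of a knotoid diagram on the sphere `S²`. With `n` crossings there are
`n + 2` vertices (crossings and endpoints) and `2 n + 1` edges, so that genus zero means that there
are `n + 1` faces; here `c.length = 2 n`. -/
def IsSpherical (c : GaussCode) : Prop :=
  c.IsWellFormed ∧ 2 * c.faceCount = c.length + 2

/-- First Reidemeister move: a kink is created. -/
inductive Omega1 : GaussCode → GaussCode → Prop
  | mk (l₀ l₁ : GaussCode) (a : ℕ) (o s : Bool) :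
      Omega1 (l₀ ++ l₁) (l₀ ++ [(a, o, s), (a, !o, s)] ++ l₁)

/-- Second Reidemeister move: a piece of the arc is pushed over another one; the two strands of the
new bigon are `P`, `Q`, in the order in which the arc runs through them. -/
inductive Omega2 : GaussCode → GaussCode → Prop
  | mk (l₀ l₁ l₂ P Q upper lower : GaussCode) (a b : ℕ) (s : Bool)
      (hupper : upper = [(a, true, s), (b, true, !s)])
      (hlower : lower = [(a, false, s), (b, false, !s)] ∨ lower = [(b, false, !s), (a, false, s)])
      (hPQ : (P = upper ∧ Q = lower) ∨ (P = lower ∧ Q = upper)) :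
      Omega2 (l₀ ++ l₁ ++ l₂) (l₀ ++ P ++ l₁ ++ Q ++ l₂)

/-- The passes `u`, `v` in this order if `d = true`, and in the opposite order otherwise. -/
def strand (d : Bool) (u v : ℕ × Bool × Bool) : GaussCode := if d then [u, v] else [v, u]

/-- Third Reidemeister move. The top and middle strands cross at `x`, the top and bottom strands at
`y`, the middle and bottom strands at `z`, and `P`, `Q`, `R` are the three strands in the order in which
the arc runs through them. The equations between the signs `εx`, `εy`, `εz` and the directions of the
strands say that the three strands bound a triangular face. -/
inductive Omega3 : GaussCode → GaussCode → Prop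
  | mk (l₀ l₁ l₂ l₃ P Q R : GaussCode) (x y z : ℕ) (εx εy εz top mid bot : Bool)
      (hxy : (εx ^^ top ^^ mid) = (εy ^^ top ^^ bot))
      (hyz : (εy ^^ top ^^ bot) = (εz ^^ mid ^^ bot))
      (hPQR : [P, Q, R].Perm
        [strand top (x, true, εx) (y, true, εy),
         strand mid (x, false, εx) (z, true, εz),
         strand bot (y, false, εy) (z, false, εz)]) :
      Omega3 (l₀ ++ P ++ l₁ ++ Q ++ l₂ ++ R ++ l₃)
        (l₀ ++ P.reverse ++ l₁ ++ Q.reverse ++ l₂ ++ R.reverse ++ l₃)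

/-- One step between codes: the crossings are renamed, or a Reidemeister move is made between two
diagrams on the sphere. Since a diagram of an arc on `S²` is determined up to isotopy
by its signed Gauss code, and no move involves an endpoint, these steps generate the equivalence of
knotoid diagrams on `S²`. -/
inductive Step : GaussCode → GaussCode → Prop
  | rename (c : GaussCode) (f : ℕ → ℕ) (hf : Function.Injective f) :
      Step c (c.map fun e => (f e.1, e.2))
  | move (c c' : GaussCode) (hc : c.IsSpherical) (hc' : c'.IsSpherical)
      (h : Omega1 c c' ∨ Omega2 c c' ∨ Omega3 c c') : Step c c'

/-- Equivalence of knotoid diagrams on `S²`. -/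
def KnotoidEquiv : GaussCode → GaussCode → Prop := Relation.EqvGen Step

/-- The diagrams with two crossings of equal sign, passed in the order `0, 1, 0, 1`, alternately
`over, under, under, over` or `under, over, over, under`. They are the standard diagram of the
knotoid `k2.1` and its mirror images (under change of all crossings, reflection of the sphere,
or both). -/
def k21 (o s : Bool) : GaussCode := [(0, o, s), (1, !o, s), (0, !o, s), (1, o, s)]

/-- The code represents the knotoid `k2.1` (knotoid types being taken up to mirror images). -/
def IsK21 (c : GaussCode) : Prop := ∃ o s, KnotoidEquiv c (k21 o s)

end GaussCode

/-! ### Polygonal chains in 3-space and their projections -/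

section Chain

variable {n : ℕ}

/-- The point with parameter `x.2 ∈ [0, 1]` on the edge number `x.1`, counted from `0`, of the chain
with the vertices `p 0, …, p n`. -/
def chainPoint (p : Fin (n + 1) → E3) (x : Fin n × ℝ) : E3 :=
  AffineMap.lineMap (p x.1.castSucc) (p x.1.succ) x.2

/-- The vector along the edge number `i`. -/
def edgeVec (p : Fin (n + 1) → E3) (i : Fin n) : E3 := p i.succ - p i.castSucc

/-- The chain is a simple (embedded) arc: no point of it is reached at two different times. -/
def IsSimpleChain (p : Fin (n + 1) → E3) : Prop :=
  ∀ x y : Fin n × ℝ, x.2 ∈ Set.Icc (0 : ℝ) 1 → y.2 ∈ Set.Icc (0 : ℝ) 1 →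
    chainPoint p x = chainPoint p y → (x.1 : ℝ) + x.2 = (y.1 : ℝ) + y.2

/-- The chain with reversed orientation. -/
def reverseChain (p : Fin (n + 1) → E3) : Fin (n + 1) → E3 := fun k => p k.rev

/-- The orthogonal projection along the unit vector `ξ`, onto the plane with normal vector `ξ`. -/
def proj (ξ v : E3) : E3 := v - inner ℝ v ξ • ξ

/-- The projection along `ξ` is generic: a vertex is not projected onto any other point
of the projected chain, and no three points of the chain have the same projection. -/
def IsGeneric (p : Fin (n + 1) → E3) (ξ : E3) : Prop :=
  (∀ x y : Fin n × ℝ, (x.2 = 0 ∨ x.2 = 1) → y.2 ∈ Set.Icc (0 : ℝ) 1 →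
    proj ξ (chainPoint p x) = proj ξ (chainPoint p y) → (x.1 : ℝ) + x.2 = (y.1 : ℝ) + y.2) ∧
  ∀ x y z : Fin n × ℝ,
    x.2 ∈ Set.Ioo (0 : ℝ) 1 → y.2 ∈ Set.Ioo (0 : ℝ) 1 → z.2 ∈ Set.Ioo (0 : ℝ) 1 →
    proj ξ (chainPoint p x) = proj ξ (chainPoint p y) →
    proj ξ (chainPoint p y) = proj ξ (chainPoint p z) → x = y ∨ y = z ∨ x = z

/-- The projections along `ξ` of the edges of the chain cross at the interior points with the
parameters `x` and `y`. -/
def CrossAt (p : Fin (n + 1) → E3) (ξ : E3) (x y : Fin n × ℝ) : Prop :=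
  x ≠ y ∧ x.2 ∈ Set.Ioo (0 : ℝ) 1 ∧ y.2 ∈ Set.Ioo (0 : ℝ) 1 ∧
    proj ξ (chainPoint p x) = proj ξ (chainPoint p y)

/-- At a crossing, the strand through `x` passes over the strand through `y`, seen from the
side to which `ξ` points. -/
def Above (p : Fin (n + 1) → E3) (ξ : E3) (x y : Fin n × ℝ) : Prop :=
  inner ℝ (chainPoint p y) ξ < inner ℝ (chainPoint p x) ξ

/-- The crossing at `x`, `y` is positive: seen from the side to which `ξ` points, the lower strand
crosses the upper strand from right to left. -/
def PositiveAt (p : Fin (n + 1) → E3) (ξ : E3) (x y : Fin n × ℝ) : Prop :=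
  0 < inner ℝ (cross (edgeVec p x.1) (edgeVec p y.1)) ξ *
    (inner ℝ (chainPoint p x) ξ - inner ℝ (chainPoint p y) ξ)

open Classical in
/-- `c` is the signed Gauss code of the projection of the chain along `ξ`: `L` lists all passes
through crossings in the order in which they occur along the chain, and `f` names the crossings. -/
def IsGaussCodeOf (p : Fin (n + 1) → E3) (ξ : E3) (c : GaussCode) : Prop :=
  ∃ (L : List (Fin n × ℝ)) (f : E3 → ℕ),
    L.Pairwise (fun x y => x.1 < y.1 ∨ x.1 = y.1 ∧ x.2 < y.2) ∧
    (∀ x, x ∈ L ↔ ∃ y, CrossAt p ξ x y) ∧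
    Set.InjOn f {q | ∃ x ∈ L, q = proj ξ (chainPoint p x)} ∧
    c = L.map fun x => (f (proj ξ (chainPoint p x)),
      decide (∃ y, CrossAt p ξ x y ∧ Above p ξ x y),
      decide (∃ y, CrossAt p ξ x y ∧ PositiveAt p ξ x y))

/-- The projection of the chain along `ξ` is generic and is a diagram of the knotoid `k2.1`. -/
def ProjectsToK21 (p : Fin (n + 1) → E3) (ξ : E3) : Prop :=
  IsGeneric p ξ ∧ ∃ c, IsGaussCodeOf p ξ c ∧ c.IsK21

/-- The sign of the crossing between the projections of the edges `i` and `j` (whenever they cross),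
which is the sign of the integrand of their Gauss linking integral and does not depend on
the direction of projection. -/
def crossingSign (p : Fin (n + 1) → E3) (i j : Fin n) : SignType :=
  SignType.sign
    (inner ℝ (cross (edgeVec p i) (edgeVec p j)) (p i.castSucc - p j.castSucc))

end Chain

/-! ### Chains with four edges

The edges `e₁, e₂, e₃, e₄` of the chain `p 0, …, p 4` have the numbers `0, 1, 2, 3`. -/

/-- The projection along `ξ` is the `k2.1` diagram of the first kind, B(i): there are exactly
two crossings, of `e₁` with `e₃` and of `e₁` with `e₄`, they have the same sign, and `e₁` passes first
through the crossing with `e₃`. -/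
def IsDiagramBi (p : Fin 5 → E3) (ξ : E3) : Prop :=
  IsGeneric p ξ ∧
  (∃ s t s' t' : ℝ, CrossAt p ξ (0, s) (2, t) ∧ CrossAt p ξ (0, s') (3, t') ∧ s < s' ∧
    (PositiveAt p ξ (0, s) (2, t) ↔ PositiveAt p ξ (0, s') (3, t'))) ∧
  ¬ ∃ s t : ℝ, CrossAt p ξ (1, s) (3, t)

/-- The projection along `ξ` is the `k2.1` diagram of the second kind, B(ii): there are exactly
two crossings, of `e₂` with `e₄` and of `e₁` with `e₄`, they have the same sign, and `e₄` passes last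
through the crossing with `e₂`. -/
def IsDiagramBii (p : Fin 5 → E3) (ξ : E3) : Prop :=
  IsGeneric p ξ ∧
  (∃ s t s' t' : ℝ, CrossAt p ξ (1, s) (3, t) ∧ CrossAt p ξ (0, s') (3, t') ∧ t' < t ∧
    (PositiveAt p ξ (1, s) (3, t) ↔ PositiveAt p ξ (0, s') (3, t'))) ∧
  ¬ ∃ s t : ℝ, CrossAt p ξ (0, s) (2, t)

/-! ### Areas on the unit sphere -/

/-- The surface area measure of the unit sphere in `E3`. -/
def sphereMeasure : MeasureTheory.Measure (Metric.sphere (0 : E3) 1) :=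
  (MeasureTheory.volume : MeasureTheory.Measure E3).toSphere

/-- The set of directions with a given property. -/
def directions (D : E3 → Prop) : Set (Metric.sphere (0 : E3) 1) := {ξ | D ξ}

/-- The probability that a random direction has a given property: the area of the set of these
directions over the area of the sphere. -/
def dirProb (D : E3 → Prop) : ℝ :=
  sphereMeasure.real (directions D) / sphereMeasure.real Set.univ

/-- The area of the spherical polygon `(w₁, …, w_k)` bounded by the great circles with normal vectors
`w₁, …, w_k`, which point to its inside. -/
def polygonArea (ws : List E3) : ℝ :=
  sphereMeasure.real {ξ | ∀ w ∈ ws, 0 < inner ℝ w (ξ : E3)}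

/-! ### The quantities in the formula -/

/-- The unit vector in the direction of `a × b`. -/
def unitNormal (a b : E3) : E3 := ‖cross a b‖⁻¹ • cross a b

/-- The normal vector `n₁` of the quadrilateral formed by the edges `a a'` and `b b'`, perpendicular to
its face `a b b'`. -/
def quadNormal₁ (a _a' b b' : E3) : E3 := unitNormal (a - b) (a - b')

/-- The normal vector `n₂` of that quadrilateral, perpendicular to its face `a a' b'`. -/
def quadNormal₂ (a a' _b b' : E3) : E3 := unitNormal (a - b') (a' - b')

/-- The normal vector `n₃` of that quadrilateral, perpendicular to its face `a' b b'`. -/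
def quadNormal₃ (_a a' b b' : E3) : E3 := unitNormal (a' - b') (a' - b)

/-- The normal vector `n₄` of that quadrilateral, perpendicular to its face `a a' b`. -/
def quadNormal₄ (a a' b _b' : E3) : E3 := unitNormal (a' - b) (a - b)

/-- `n₁` for the edges `e₁`, `e₃`. -/
def vn₁ (p : Fin 5 → E3) : E3 := quadNormal₁ (p 0) (p 1) (p 2) (p 3)
/-- `n₂` for the edges `e₁`, `e₃`. -/
def vn₂ (p : Fin 5 → E3) : E3 := quadNormal₂ (p 0) (p 1) (p 2) (p 3)
/-- `n₃` for the edges `e₁`, `e₃`. -/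
def vn₃ (p : Fin 5 → E3) : E3 := quadNormal₃ (p 0) (p 1) (p 2) (p 3)
/-- `n₄` for the edges `e₁`, `e₃`. -/
def vn₄ (p : Fin 5 → E3) : E3 := quadNormal₄ (p 0) (p 1) (p 2) (p 3)
/-- `u₂` for the edges `e₁`, `e₄`. -/
def vu₂ (p : Fin 5 → E3) : E3 := quadNormal₂ (p 0) (p 1) (p 3) (p 4)
/-- `v₂` for the edges `e₂`, `e₄`. -/
def vv₂ (p : Fin 5 → E3) : E3 := quadNormal₂ (p 1) (p 2) (p 3) (p 4)
/-- `v₃` for the edges `e₂`, `e₄`. -/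
def vv₃ (p : Fin 5 → E3) : E3 := quadNormal₃ (p 1) (p 2) (p 3) (p 4)

/-- `ε₁₃`. -/
def eps13 (p : Fin 5 → E3) : SignType := crossingSign (n := 4) p 0 2
/-- `ε₁₄`. -/
def eps14 (p : Fin 5 → E3) : SignType := crossingSign (n := 4) p 0 3

/-- `w = (u₂ × (-n₂)) · (u₂ × n₄)`. -/
def wInv (p : Fin 5 → E3) : ℝ := inner ℝ (cross (vu₂ p) (-vn₂ p)) (cross (vu₂ p) (vn₄ p))

/-- `w₀ = (v₃ × (-n₁)) · (v₃ × n₃)`. -/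
def w0Inv (p : Fin 5 → E3) : ℝ := inner ℝ (cross (vv₃ p) (-vn₁ p)) (cross (vv₃ p) (vn₃ p))

/-- `c₄₁ = (p₄₁ · n₁) ε₁₃`, where `p₄₁` is the vector from the vertex `4` to the vertex `1`. -/
def c41 (p : Fin 5 → E3) : ℝ := inner ℝ (p 1 - p 4) (vn₁ p) * ((eps13 p : SignType) : ℝ)

end

/-! Off a null set of directions the projection is generic and only the pairs `e₁e₃`, `e₁e₄`, `e₂e₄`
can cross (`ae_isRegularDirection`, `CrossAt.nonadjacent`). Two things remain: to decide which
patterns of these crossings represent k2.1, and to describe the directions that produce them.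

Topology. The odd writhe, the sum of the signs of the crossings whose two passes enclose an odd
number of passes, is invariant under the Reidemeister moves and nonzero for k2.1. It vanishes on all
patterns except an alternating one `a b a b` with equal signs: one crossing, nested crossings `a b b
a`, and three crossings, which can only occur in the order `a b c a b c`, have even crossings only.
Crossings `e₁e₃` and `e₂e₄` without `e₁e₄` are impossible (`BracketRel.cross_of_cross`). Conversely,
an alternating pattern with equal signs has alternating heights, since a polyline that crosses an
edge twice in succession crosses it in opposite directions; its code is then `k21` itself. This is
`projectsToK21_iff`.

Geometry. Whether two edges cross, where, and in which order is expressed by the signs of brackets,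
the signed areas of projected triangles of vertices. The brackets are tied together by Plücker
relations and by the affine relation `∑ volᵢ pᵢ = 0`, `∑ volᵢ = 0`, whose coefficients do not depend
on `ξ`; `BracketRel` collects what is needed. A diagram B(i) forces `vol₀`, `vol₁` to have one
strict sign and `vol₂`, `vol₃`, `vol₄` the other: this is the Radon partition in which the edge `e₁`
pierces the triangle `p₂p₃p₄`. The signs of `w`, `w₀` and the equality of `ε₁₃`, `ε₁₄` express
exactly this (`isPiercing_iff`). Conversely, once the edge pierces the triangle, four bracket
inequalities imply all other sign conditions (`BracketRel.of_polygon`), so that the directions of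
B(i) form a spherical polygon and its antipode (`isDiagramBi_iff`). If `c₄₁ ≤ 0`, the inequality for
`n₁` follows from the other three (`BracketRel.n₁_pos_of_triangle`) and the polygon is a triangle.
Two antipodal copies over the total area `4π` give the factor `1/(2π)`.

Reversal of the chain exchanges B(i) and B(ii) (`isDiagramBii_iff_reverse`). -/

/-! ### The odd writhe as an invariant of knotoids -/

namespace GaussCode

/-- The sum, modulo two, of the positions of the passes through the crossing `a`, the first pass of
the code being at position `k`. -/
def posSum (a : ℕ) : ZMod 2 → GaussCode → ZMod 2
  | _, [] => 0
  | k, x :: l => (if x.1 = a then k else 0) + posSum a (k + 1) l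

/-- The number, modulo two, of the passes through the crossing `a`. -/
def passCount (a : ℕ) (l : GaussCode) : ZMod 2 := (l.map fun x => if x.1 = a then 1 else 0).sum

/-- The sign of a crossing as an integer. -/
def signInt (s : Bool) : ℤ := if s then 1 else -1

/-- The contribution of a pass to the odd writhe of a code. -/
def oddTerm (c : GaussCode) (x : ℕ × Bool × Bool) : ℤ :=
  -- Passes at positions `i < j` enclose `j - i - 1` passes, an odd number exactly if `i + j` is
  -- even.
  if posSum x.1 0 c = 0 then signInt x.2.2 else 0

/-- Twice the odd writhe: the sum of the signs of the passes through odd crossings. -/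
def oddWrithe (c : GaussCode) : ℤ := (c.map (oddTerm c)).sum

theorem posSum_append (a : ℕ) (k : ZMod 2) (l m : GaussCode) :
    posSum a k (l ++ m) = posSum a k l + posSum a (k + l.length) m := by
  induction l generalizing k with
  | nil => simp [posSum]
  | cons x l ih =>
    simp only [List.cons_append, posSum, ih, List.length_cons, Nat.cast_add, Nat.cast_one]
    rw [show k + 1 + (l.length : ZMod 2) = k + (l.length + 1) by ring]; ring

theorem posSum_eq_zero_of_notMem {a : ℕ} {l : GaussCode} (h : ∀ x ∈ l, x.1 ≠ a) (k : ZMod 2) :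
    posSum a k l = 0 := by
  induction l generalizing k with
  | nil => rfl
  | cons x l ih =>
    simp only [List.mem_cons, forall_eq_or_imp] at h
    simp [posSum, h.1, ih h.2]

theorem posSum_map {f : ℕ → ℕ} (hf : Function.Injective f) (a : ℕ) (k : ZMod 2) (c : GaussCode) :
    posSum (f a) k (c.map fun e => (f e.1, e.2)) = posSum a k c := by
  induction c generalizing k with
  | nil => rfl
  | cons x l ih => simp only [List.map_cons, posSum, ih, hf.eq_iff]

theorem oddWrithe_map {f : ℕ → ℕ} (hf : Function.Injective f) (c : GaussCode) :
    oddWrithe (c.map fun e => (f e.1, e.2)) = oddWrithe c := by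
  simp only [oddWrithe, List.map_map]
  congr 2
  funext x
  simp [oddTerm, posSum_map hf]

theorem oddWrithe_congr_of_perm {c c' : GaussCode} (hp : c.Perm c')
    (h : ∀ a, posSum a 0 c = posSum a 0 c') : oddWrithe c = oddWrithe c' := by
  have : oddTerm c = oddTerm c' := by funext x; simp [oddTerm, h]
  rw [oddWrithe, oddWrithe, this]
  exact (hp.map _).sum_eq

/-- Exchanging two adjacent passes moves each of them by one position, which changes the sum once
for every pass through `a`. -/
theorem posSum_reverse_of_length_two {P : GaussCode} (hP : P.length = 2) (a : ℕ) (k : ZMod 2) :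
    posSum a k P.reverse = posSum a k P + passCount a P := by
  obtain ⟨u, v, rfl⟩ := List.length_eq_two.1 hP
  have h2 : (2 : ZMod 2) = 0 := rfl
  simp only [List.reverse_cons, List.reverse_nil, List.nil_append, List.cons_append, posSum,
    passCount, List.map_cons, List.map_nil, List.sum_cons, List.sum_nil]
  split_ifs <;> first | ring1 | linear_combination -h2

/-- Each crossing of the triangle lies on two of the three reversed strands, so two of its positions
change by one and the parity of their sum is kept. -/
theorem oddWrithe_omega3 {c c' : GaussCode} (h : Omega3 c c') : oddWrithe c = oddWrithe c' := by
  obtain ⟨l₀, l₁, l₂, l₃, P, Q, R, x, y, z, εx, εy, εz, top, mid, bot, -, -, hPQR⟩ := h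
  have hlen : ∀ S ∈ [P, Q, R], S.length = 2 := by
    intro S hS
    have := hPQR.mem_iff.1 hS
    simp only [List.mem_cons, List.not_mem_nil, or_false] at this
    rcases this with rfl | rfl | rfl <;> (unfold strand; split_ifs <;> rfl)
  have hP := hlen P (by simp)
  have hQ := hlen Q (by simp)
  have hR := hlen R (by simp)
  have hcount : ∀ a, passCount a P + passCount a Q + passCount a R = 0 := by
    intro a
    have := (hPQR.map (passCount a)).sum_eq
    simp only [List.map_cons, List.map_nil, List.sum_cons, List.sum_nil, add_zero] at this
    rw [add_assoc, this]
    have h2 : (2 : ZMod 2) = 0 := rfl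
    have key : ∀ d u v, passCount a (strand d u v) =
        (if u.1 = a then 1 else 0) + (if v.1 = a then 1 else 0) := by
      intro d u v
      cases d <;> simp [strand, passCount, add_comm]
    simp only [key]
    linear_combination ((if x = a then 1 else 0) + (if y = a then 1 else 0) +
      (if z = a then 1 else 0)) * h2
  refine oddWrithe_congr_of_perm ?_ ?_
  · exact (((((((List.Perm.refl _).append P.reverse_perm.symm).append (List.Perm.refl _)).append
      Q.reverse_perm.symm).append (List.Perm.refl _)).append R.reverse_perm.symm).append
      (List.Perm.refl _))
  · intro a
    simp only [posSum_append, List.length_append, List.length_reverse,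
      posSum_reverse_of_length_two hP, posSum_reverse_of_length_two hQ,
      posSum_reverse_of_length_two hR]
    linear_combination -hcount a

theorem IsWellFormed.sign_eq {c : GaussCode} (hc : c.IsWellFormed) {a : ℕ} {o s o' s' : Bool}
    (h : (a, o, s) ∈ c) (h' : (a, o', s') ∈ c) : s' = s := by
  by_contra hne
  have : s' = !s := by cases s <;> cases s' <;> simp_all
  exact (hc.2 a o s h).2 o' (this ▸ h')

/-- A crossing has only two passes, so one that is passed twice within `l'` cannot occur in the
rest. This makes the names introduced by a Reidemeister move fresh. -/
theorem IsWellFormed.ne_of_mem {l l' : GaussCode} (hc : (l' ++ l).IsWellFormed) {a : ℕ} {s : Bool}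
    (h : ∀ o, (a, o, s) ∈ l') : ∀ x ∈ l, x.1 ≠ a := by
  rintro ⟨b, o, s'⟩ hx rfl
  have : s' = s := hc.sign_eq (List.mem_append_left _ (h o)) (List.mem_append_right _ hx)
  subst this
  exact (List.disjoint_of_nodup_append hc.1) (h o) hx

theorem IsWellFormed.perm {c c' : GaussCode} (hc : c.IsWellFormed) (h : c.Perm c') :
    c'.IsWellFormed := by
  refine ⟨h.nodup_iff.1 hc.1, fun a o s hm => ?_⟩
  have := hc.2 a o s (h.mem_iff.2 hm)
  exact ⟨h.mem_iff.1 this.1, fun o' ho => this.2 o' (h.mem_iff.2 ho)⟩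

/-- The two passes of a kink are adjacent, so the new crossing is even and contributes nothing; all
later positions shift by two. -/
theorem oddWrithe_omega1 {c c' : GaussCode} (hc' : c'.IsWellFormed) (h : Omega1 c c') :
    oddWrithe c = oddWrithe c' := by
  obtain ⟨l₀, l₁, a, o, s⟩ := h
  have hperm : (l₀ ++ [(a, o, s), (a, !o, s)] ++ l₁).Perm ([(a, o, s), (a, !o, s)] ++ (l₀ ++ l₁)) := by
    rw [← List.append_assoc]
    exact List.perm_append_comm.append (List.Perm.refl _)
  have hne := (hc'.perm hperm).ne_of_mem (a := a) (s := s) (by intro o'; cases o <;> cases o' <;> simp)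
  have h2 : (2 : ZMod 2) = 0 := rfl
  have hpos : ∀ b, b ≠ a → posSum b 0 (l₀ ++ [(a, o, s), (a, !o, s)] ++ l₁) =
      posSum b 0 (l₀ ++ l₁) := by
    intro b hb
    simp only [posSum_append, posSum, hb.symm, if_false, List.length_append, List.length_cons,
      List.length_nil, zero_add, add_zero, Nat.cast_add]
    congr 2
    push_cast
    linear_combination h2
  have ha : posSum a 0 (l₀ ++ [(a, o, s), (a, !o, s)] ++ l₁) = 1 := by
    simp only [posSum_append, posSum, if_true,
      posSum_eq_zero_of_notMem fun x hx => hne x (List.mem_append_left _ hx),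
      posSum_eq_zero_of_notMem fun x hx => hne x (List.mem_append_right _ hx)]
    linear_combination (l₀.length : ZMod 2) * h2
  have hsum := (hperm.map (oddTerm (l₀ ++ [(a, o, s), (a, !o, s)] ++ l₁))).sum_eq
  rw [oddWrithe, oddWrithe, hsum]
  simp only [List.map_append, List.sum_append, List.map_cons, List.map_nil, List.sum_cons,
    List.sum_nil]
  have hz : ∀ o', oddTerm (l₀ ++ [(a, o, s), (a, !o, s)] ++ l₁) (a, o', s) = 0 := by
    intro o'; simp only [oddTerm, ha]; simp
  rw [hz, hz, ← List.sum_append, ← List.map_append, ← List.sum_append, ← List.map_append]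
  simp only [add_zero, zero_add]
  congr 1
  refine List.map_congr_left fun x hx => ?_
  simp only [oddTerm, hpos x.1 (hne x hx)]

/-- The passes through `a` and `b` are neighbours on both strands, so the two crossings have the
same parity; their signs are opposite and the contributions cancel. Other positions shift by an even
number. -/
theorem oddWrithe_omega2 {c c' : GaussCode} (hc' : c'.IsWellFormed) (h : Omega2 c c') :
    oddWrithe c = oddWrithe c' := by
  obtain ⟨l₀, l₁, l₂, P, Q, upper, lower, a, b, s, hupper, hlower, hPQ⟩ := h
  have hperm : (l₀ ++ P ++ l₁ ++ Q ++ l₂).Perm ((P ++ Q) ++ (l₀ ++ l₁ ++ l₂)) := by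
    rw [List.perm_iff_count]; intro x; simp only [List.count_append]; ring
  have hPQ' : (P ++ Q).Perm
      [(a, true, s), (a, false, s), (b, true, !s), (b, false, !s)] := by
    rw [List.perm_iff_count]
    intro x
    rcases hlower with rfl | rfl <;> rcases hPQ with ⟨rfl, rfl⟩ | ⟨rfl, rfl⟩ <;>
      simp only [hupper, List.count_append, List.count_cons, List.count_nil] <;> ring
  have hwf := hc'.perm hperm
  have hnea := hwf.ne_of_mem (a := a) (s := s) (by
    intro o'; rw [hPQ'.mem_iff]; cases o' <;> simp)
  have hneb := hwf.ne_of_mem (a := b) (s := !s) (by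
    intro o'; rw [hPQ'.mem_iff]; cases o' <;> simp)
  have hab : a ≠ b := by
    rintro rfl
    have h1 : (a, true, s) ∈ (P ++ Q) ++ (l₀ ++ l₁ ++ l₂) :=
      List.mem_append_left _ (hPQ'.mem_iff.2 (by simp))
    have h2 : (a, true, !s) ∈ (P ++ Q) ++ (l₀ ++ l₁ ++ l₂) :=
      List.mem_append_left _ (hPQ'.mem_iff.2 (by simp))
    have := hwf.sign_eq h1 h2
    cases s <;> simp at this
  have h2 : (2 : ZMod 2) = 0 := rfl
  have hlen : P.length = 2 ∧ Q.length = 2 := by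
    rcases hlower with rfl | rfl <;> rcases hPQ with ⟨rfl, rfl⟩ | ⟨rfl, rfl⟩ <;> subst hupper <;>
      exact ⟨rfl, rfl⟩
  have hlenP : (P.length : ZMod 2) = 0 := by rw [hlen.1]; exact ZMod.natCast_self 2
  have hlenQ : (Q.length : ZMod 2) = 0 := by rw [hlen.2]; exact ZMod.natCast_self 2
  have hPQmem : ∀ d, d ≠ a → d ≠ b → ∀ x ∈ P ++ Q, x.1 ≠ d := by
    intro d hda hdb x hx
    rw [hPQ'.mem_iff] at hx
    simp only [List.mem_cons, List.not_mem_nil, or_false] at hx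
    rcases hx with rfl | rfl | rfl | rfl <;> simp [hda.symm, hdb.symm]
  have hpos : ∀ d, d ≠ a → d ≠ b → posSum d 0 (l₀ ++ P ++ l₁ ++ Q ++ l₂) =
      posSum d 0 (l₀ ++ l₁ ++ l₂) := by
    intro d hda hdb
    have hm := hPQmem d hda hdb
    simp only [posSum_append, List.length_append, Nat.cast_add, hlenP, hlenQ, add_zero,
      posSum_eq_zero_of_notMem fun x hx => hm x (List.mem_append_left _ hx),
      posSum_eq_zero_of_notMem fun x hx => hm x (List.mem_append_right _ hx)]
  have heq : posSum a 0 (l₀ ++ P ++ l₁ ++ Q ++ l₂) = posSum b 0 (l₀ ++ P ++ l₁ ++ Q ++ l₂) := by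
    have hl : ∀ (d : ℕ), (∀ x ∈ l₀ ++ l₁ ++ l₂, x.1 ≠ d) →
        posSum d 0 (l₀ ++ P ++ l₁ ++ Q ++ l₂) =
          posSum d l₀.length P + posSum d (l₀.length + l₁.length) Q := by
      intro d hd
      simp only [posSum_append, List.length_append, Nat.cast_add, hlenP, hlenQ, add_zero, zero_add,
        posSum_eq_zero_of_notMem fun x hx => hd x (List.mem_append_right _ hx),
        posSum_eq_zero_of_notMem fun x hx =>
          hd x (List.mem_append_left _ (List.mem_append_left _ hx)),
        posSum_eq_zero_of_notMem fun x hx =>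
          hd x (List.mem_append_left _ (List.mem_append_right _ hx))]
    rw [hl a hnea, hl b hneb]
    rcases hlower with rfl | rfl <;> rcases hPQ with ⟨rfl, rfl⟩ | ⟨rfl, rfl⟩ <;> subst hupper <;>
      simp only [posSum, hab, hab.symm, if_true, if_false] <;>
      first | ring1 | linear_combination -h2
  have hsum := (hperm.map (oddTerm (l₀ ++ P ++ l₁ ++ Q ++ l₂))).sum_eq
  have hsum' := (hPQ'.map (oddTerm (l₀ ++ P ++ l₁ ++ Q ++ l₂))).sum_eq
  rw [oddWrithe, oddWrithe, hsum, List.map_append (l₁ := P ++ Q), List.sum_append, hsum']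
  have hz : (List.map (oddTerm (l₀ ++ P ++ l₁ ++ Q ++ l₂))
      [(a, true, s), (a, false, s), (b, true, !s), (b, false, !s)]).sum = 0 := by
    simp only [List.map_cons, List.map_nil, List.sum_cons, List.sum_nil, oddTerm, heq]
    split_ifs <;> cases s <;> simp [signInt]
  rw [hz, zero_add]
  congr 1
  refine List.map_congr_left fun x hx => ?_
  simp only [oddTerm, hpos x.1 (hnea x hx) (hneb x hx)]

theorem oddWrithe_step {c c' : GaussCode} (h : Step c c') : oddWrithe c = oddWrithe c' := by
  cases h with
  | rename f hf => exact (oddWrithe_map hf c).symm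
  | move _ hc hc' h =>
    rcases h with h | h | h
    · exact oddWrithe_omega1 hc'.1 h
    · exact oddWrithe_omega2 hc'.1 h
    · exact oddWrithe_omega3 h

theorem KnotoidEquiv.oddWrithe_eq {c c' : GaussCode} (h : KnotoidEquiv c c') :
    oddWrithe c = oddWrithe c' := by
  induction h with
  | rel _ _ h => exact oddWrithe_step h
  | refl => rfl
  | symm _ _ _ ih => exact ih.symm
  | trans _ _ _ _ _ ih ih' => exact ih.trans ih'

theorem oddWrithe_k21 (o s : Bool) : oddWrithe (k21 o s) = 4 * signInt s := by
  revert o s; decide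

theorem IsK21.oddWrithe_ne_zero {c : GaussCode} (h : c.IsK21) : oddWrithe c ≠ 0 := by
  obtain ⟨o, s, h⟩ := h
  rw [h.oddWrithe_eq, oddWrithe_k21]
  cases s <;> simp [signInt]

end GaussCode

/-! ### Determinants in three-dimensional space -/

/-- The determinant of three vectors. -/
noncomputable def det3 (u v w : E3) : ℝ := inner ℝ (cross u v) w

theorem cross_coord (a b : E3) : (cross a b) 0 = a 1 * b 2 - a 2 * b 1 ∧
    (cross a b) 1 = a 2 * b 0 - a 0 * b 2 ∧ (cross a b) 2 = a 0 * b 1 - a 1 * b 0 := by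
  simp [cross, crossProduct]

theorem inner_eq_sum (a b : E3) : inner ℝ a b = a 0 * b 0 + a 1 * b 1 + a 2 * b 2 := by
  simp [PiLp.inner_apply, Fin.sum_univ_three, mul_comm]

theorem det3_eq (u v w : E3) : det3 u v w = (u 1 * v 2 - u 2 * v 1) * w 0 +
    (u 2 * v 0 - u 0 * v 2) * w 1 + (u 0 * v 1 - u 1 * v 0) * w 2 := by
  rw [det3, inner_eq_sum, (cross_coord u v).1, (cross_coord u v).2.1, (cross_coord u v).2.2]

theorem E3.ext {a b : E3} (h0 : a 0 = b 0) (h1 : a 1 = b 1) (h2 : a 2 = b 2) : a = b := by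
  ext i; fin_cases i <;> assumption

/-- Plücker's relation. -/
theorem det3_plucker (a b c d x : E3) : det3 a b x * det3 c d x - det3 a c x * det3 b d x +
    det3 a d x * det3 b c x = 0 := by
  simp only [det3_eq]; ring

/-- Cramer's rule. -/
theorem det3_cramer (a b c d : E3) :
    det3 b c d • a - det3 a c d • b + det3 a b d • c - det3 a b c • d = 0 := by
  apply E3.ext <;> simp [det3_eq] <;> ring

/-- The planes with normals `a × b` and `a × c` meet in the line of `a`. This turns the invariants
`w` and `w₀` into products of volumes. -/
theorem cross_cross_cross (a b c : E3) : cross (cross a b) (cross a c) = det3 a b c • a := by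
  apply E3.ext <;> simp [det3_eq, cross_coord] <;> ring

/-- Twice the signed area of the projection of the triangle `a b c` along `ξ`. -/
noncomputable def bracket (ξ a b c : E3) : ℝ := det3 (b - a) (c - a) ξ

theorem bracket_plucker (ξ o a b c d : E3) :
    bracket ξ o a b * bracket ξ o c d - bracket ξ o a c * bracket ξ o b d +
      bracket ξ o a d * bracket ξ o b c = 0 := det3_plucker _ _ _ _ _

theorem bracket_rotate (ξ a b c : E3) : bracket ξ b c a = bracket ξ a b c := by
  simp only [bracket, det3_eq, PiLp.sub_apply]; ring

theorem bracket_swap (ξ a b c : E3) : bracket ξ a c b = -bracket ξ a b c := by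
  simp only [bracket, det3_eq, PiLp.sub_apply]; ring

/-- The faces of a tetrahedron form a closed surface, so their projected signed areas cancel. -/
theorem bracket_quad (ξ a b c d : E3) :
    bracket ξ a b c - bracket ξ a b d + bracket ξ a c d - bracket ξ b c d = 0 := by
  simp only [bracket, det3_eq, PiLp.sub_apply]; ring

theorem bracket_neg (ξ a b c : E3) : bracket (-ξ) a b c = -bracket ξ a b c := by
  simp [bracket, det3]

/-! ### Coordinates of five points -/

section Five

variable (p : Fin 5 → E3) (ξ : E3)

/-- The orientation of the tetrahedron `0 1 3 4`. -/
noncomputable def vol₂ : ℝ := det3 (p 1 - p 0) (p 3 - p 0) (p 4 - p 0)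
/-- The orientation of the tetrahedron `0 1 4 2`. -/
noncomputable def vol₃ : ℝ := -det3 (p 1 - p 0) (p 2 - p 0) (p 4 - p 0)
/-- The orientation of the tetrahedron `0 1 2 3`. -/
noncomputable def vol₄ : ℝ := det3 (p 1 - p 0) (p 2 - p 0) (p 3 - p 0)
/-- The orientation of the tetrahedron `0 2 4 3`. -/
noncomputable def vol₁ : ℝ := -det3 (p 2 - p 0) (p 3 - p 0) (p 4 - p 0)
/-- The orientation of the tetrahedron `1 2 3 4`. -/
noncomputable def vol₀ : ℝ := det3 (p 2 - p 1) (p 3 - p 1) (p 4 - p 1)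

/-- The five signed volumes are the coefficients of the affine dependence of five points in space,
which sum to zero. -/
theorem vol_sum : vol₀ p + vol₁ p + vol₂ p + vol₃ p + vol₄ p = 0 := by
  simp only [vol₀, vol₁, vol₂, vol₃, vol₄, det3_eq, PiLp.sub_apply]; ring

/-- The affine relation between five points, projected along `ξ` and seen from two points. -/
theorem vol_bracket (x y : E3) : vol₀ p * bracket ξ x y (p 0) + vol₁ p * bracket ξ x y (p 1) +
    vol₂ p * bracket ξ x y (p 2) + vol₃ p * bracket ξ x y (p 3) +
    vol₄ p * bracket ξ x y (p 4) = 0 := by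
  have h0 : vol₀ p = -(vol₁ p + vol₂ p + vol₃ p + vol₄ p) := by linarith [vol_sum p]
  have hc := det3_cramer (p 1 - p 0) (p 2 - p 0) (p 3 - p 0) (p 4 - p 0)
  -- The bracket is affine in its last point; with `vol₀` eliminated only differences from `p 0`
  -- remain, and Cramer's rule applies to them.
  have hl : ∀ z, bracket ξ x y z - bracket ξ x y (p 0) = det3 (y - x) (z - p 0) ξ := by
    intro z; simp only [bracket, det3_eq, PiLp.sub_apply]; ring
  have hlin : ∀ (u : E3) (a b c d : ℝ) (v₁ v₂ v₃ v₄ : E3),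
      det3 u (a • v₁ - b • v₂ + c • v₃ - d • v₄) ξ =
        a * det3 u v₁ ξ - b * det3 u v₂ ξ + c * det3 u v₃ ξ - d * det3 u v₄ ξ := by
    intros
    simp only [det3_eq, PiLp.sub_apply, PiLp.add_apply, PiLp.smul_apply, smul_eq_mul]; ring
  have h := hlin (y - x) _ _ _ _ _ _ _ _ |>.symm.trans (congrArg (fun v => det3 (y - x) v ξ) hc)
  have hz : det3 (y - x) 0 ξ = 0 := by simp [det3_eq]
  rw [hz, ← hl, ← hl, ← hl, ← hl] at h
  rw [h0]
  simp only [vol₁, vol₂, vol₃, vol₄]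
  linear_combination -h

end Five

/-! ### Crossings of projected edges -/

theorem cross_smul_add_smul (u v : E3) (c h : ℝ) : cross u (c • u + h • v) = h • cross u v := by
  apply E3.ext <;> simp [cross_coord] <;> ring

/-- This is the expansion `u × (u × v) = (u · v) u - (u · u) v`. -/
theorem exists_smul_of_cross_eq_zero {u v : E3} (hu : u ≠ 0) (h : cross u v = 0) :
    ∃ c : ℝ, v = c • u := by
  have hne : (inner ℝ u u : ℝ) ≠ 0 := inner_self_ne_zero.2 hu
  have e0 := congrArg (fun x : E3 => x 0) h
  have e1 := congrArg (fun x : E3 => x 1) h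
  have e2 := congrArg (fun x : E3 => x 2) h
  simp only [cross_coord, PiLp.zero_apply] at e0 e1 e2
  refine ⟨inner ℝ u v / inner ℝ u u, ?_⟩
  have key : (inner ℝ u u : ℝ) • v = (inner ℝ u v : ℝ) • u := by
    apply E3.ext <;> simp only [PiLp.smul_apply, smul_eq_mul, inner_eq_sum]
    · linear_combination u 2 * e1 - u 1 * e2
    · linear_combination -u 2 * e0 + u 0 * e2
    · linear_combination u 1 * e0 - u 0 * e1
  rw [div_eq_inv_mul, mul_smul, ← key, smul_smul, inv_mul_cancel₀ hne, one_smul]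

theorem proj_eq_proj_iff {ξ : E3} (hξ : ‖ξ‖ = 1) (u v : E3) :
    proj ξ u = proj ξ v ↔ ∃ h : ℝ, u - v = h • ξ := by
  constructor
  · intro h
    refine ⟨inner ℝ u ξ - inner ℝ v ξ, ?_⟩
    unfold proj at h
    rw [sub_smul, sub_eq_sub_iff_add_eq_add]
    rw [sub_eq_sub_iff_add_eq_add] at h
    rw [h, add_comm]
  · rintro ⟨h, hh⟩
    obtain rfl : u = v + h • ξ := by rw [← hh]; abel
    have : (inner ℝ ξ ξ : ℝ) = 1 := by rw [real_inner_self_eq_norm_sq, hξ]; norm_num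
    simp only [proj, inner_add_left, inner_smul_left, this, add_smul, conj_trivial, mul_one]
    abel

theorem inner_sub_inner_of_sub_eq {ξ u v : E3} (hξ : ‖ξ‖ = 1) {h : ℝ} (hh : u - v = h • ξ) :
    inner ℝ u ξ - inner ℝ v ξ = h := by
  rw [← inner_sub_left, hh, inner_smul_left, real_inner_self_eq_norm_sq, hξ]; simp

/-- A direction is regular for five points if it is parallel to a line or a plane through some
of them only when they are in a degenerate position. -/
structure IsRegularDirection (p : Fin 5 → E3) (ξ : E3) : Prop where
  norm_eq : ‖ξ‖ = 1
  cross_eq_zero : ∀ i j k, bracket ξ (p i) (p j) (p k) = 0 → cross (p j - p i) (p k - p i) = 0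
  eq_of_cross : ∀ i j, cross (p j - p i) ξ = 0 → p i = p j

namespace IsRegularDirection

variable {p : Fin 5 → E3} {ξ : E3}

/-- The direction `ξ` is not parallel to a line through two distinct vertices, so a displacement
along `ξ` within such a line vanishes. This lifts coincidences of projections to coincidences in
space. -/
theorem height_eq_zero (hξ : IsRegularDirection p ξ) {i j : Fin 5} (hij : p i ≠ p j) {c h : ℝ}
    (hc : cross (p j - p i) (c • (p j - p i) + h • ξ) = 0) : h = 0 := by
  rw [cross_smul_add_smul] at hc
  exact (smul_eq_zero.1 hc).resolve_right fun h' => hij (hξ.eq_of_cross i j h')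

theorem vertex_eq (hξ : IsRegularDirection p ξ) {i j k : Fin 5} (hij : p i ≠ p j) {t : ℝ}
    (h : proj ξ (p k) = proj ξ (AffineMap.lineMap (p i) (p j) t)) :
    p k = AffineMap.lineMap (p i) (p j) t := by
  obtain ⟨h, hh⟩ := (proj_eq_proj_iff hξ.norm_eq _ _).1 h
  have hk : p k - p i = t • (p j - p i) + h • ξ := by
    rw [← hh, AffineMap.lineMap_apply_module']; abel
  have hb : bracket ξ (p i) (p j) (p k) = 0 := by
    rw [bracket, hk]
    simp only [det3_eq, PiLp.add_apply, PiLp.smul_apply, smul_eq_mul]; ring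
  have hc := hξ.cross_eq_zero i j k hb
  rw [hk] at hc
  rw [hξ.height_eq_zero hij hc, zero_smul] at hh
  exact sub_eq_zero.1 hh

theorem param_eq (hξ : IsRegularDirection p ξ) {i j : Fin 5} (hij : p i ≠ p j) {s t : ℝ}
    (h : proj ξ (AffineMap.lineMap (p i) (p j) s) = proj ξ (AffineMap.lineMap (p i) (p j) t)) :
    s = t := by
  obtain ⟨h, hh⟩ := (proj_eq_proj_iff hξ.norm_eq _ _).1 h
  have h1 : (s - t) • (p j - p i) = h • ξ := by
    rw [← hh, AffineMap.lineMap_apply_module', AffineMap.lineMap_apply_module']; module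
  have h2 : h = 0 := by
    refine hξ.height_eq_zero hij (c := 0) ?_
    rw [← h1]
    simp [cross]
  rw [h2, zero_smul, smul_eq_zero] at h1
  exact sub_eq_zero.1 (h1.resolve_right fun h => hij (sub_eq_zero.1 h).symm)

/-- As `t > 0`, a common projection of points on the lines of consecutive edges makes the projected
triangle degenerate. Regularity then puts the three vertices on a line, where `height_eq_zero`
applies. -/
theorem adjacent (hξ : IsRegularDirection p ξ) {i j k : Fin 5} (hij : p i ≠ p j) {s t : ℝ}
    (ht : t ∈ Set.Ioo (0 : ℝ) 1)
    (h : proj ξ (AffineMap.lineMap (p i) (p j) s) = proj ξ (AffineMap.lineMap (p j) (p k) t)) :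
    AffineMap.lineMap (p i) (p j) s = (AffineMap.lineMap (p j) (p k) t : E3) := by
  obtain ⟨h, hh⟩ := (proj_eq_proj_iff hξ.norm_eq _ _).1 h
  have hk : t • (p k - p i) = (s - 1 + t) • (p j - p i) + (-h) • ξ := by
    rw [neg_smul, ← hh, AffineMap.lineMap_apply_module', AffineMap.lineMap_apply_module']; module
  have hb : t * bracket ξ (p i) (p j) (p k) = 0 := by
    have : t * bracket ξ (p i) (p j) (p k) = det3 (p j - p i) (t • (p k - p i)) ξ := by
      simp only [bracket, det3_eq, PiLp.smul_apply, smul_eq_mul]; ring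
    rw [this, hk]
    simp only [det3_eq, PiLp.add_apply, PiLp.smul_apply, smul_eq_mul]; ring
  have hc := hξ.cross_eq_zero i j k ((mul_eq_zero.1 hb).resolve_left ht.1.ne')
  have hc' : cross (p j - p i) (t • (p k - p i)) = 0 := by
    have : cross (p j - p i) (t • (p k - p i)) = t • cross (p j - p i) (p k - p i) := by
      simp [cross]
    rw [this, hc, smul_zero]
  rw [hk] at hc'
  rw [neg_eq_zero.1 (hξ.height_eq_zero hij hc'), zero_smul] at hh
  exact sub_eq_zero.1 hh

end IsRegularDirection

theorem mul_neg_of_convex_comb {x y t : ℝ} (ht : t ∈ Set.Ioo (0 : ℝ) 1) (hx : x ≠ 0)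
    (h : (1 - t) * x + t * y = 0) : x * y < 0 := by
  have h1 : t * (x * y) = -((1 - t) * x ^ 2) := by linear_combination x * h
  have h2 : 0 < (1 - t) * x ^ 2 := mul_pos (by linarith [ht.2]) (by positivity)
  by_contra hc
  have := mul_nonneg ht.1.le (not_lt.1 hc)
  linarith

/-- A point that projects onto the line `a b` has zero bracket with `a` and `b`, and the bracket is
affine along `c d`; then the two lines exchange roles. -/
theorem bracket_lineMap_sub {ξ a b c d : E3} {s t h : ℝ}
    (hh : AffineMap.lineMap a b s - AffineMap.lineMap c d t = h • ξ) :
    (1 - t) * bracket ξ a b c + t * bracket ξ a b d = 0 ∧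
      (1 - s) * bracket ξ c d a + s * bracket ξ c d b = 0 := by
  have h1 : det3 (b - a) (AffineMap.lineMap a b s - AffineMap.lineMap c d t) ξ = 0 := by
    rw [hh]; simp only [det3_eq, PiLp.smul_apply, smul_eq_mul]; ring
  have h2 : det3 (d - c) (AffineMap.lineMap a b s - AffineMap.lineMap c d t) ξ = 0 := by
    rw [hh]; simp only [det3_eq, PiLp.smul_apply, smul_eq_mul]; ring
  simp only [AffineMap.lineMap_apply_module', det3_eq, PiLp.sub_apply, PiLp.add_apply,
    PiLp.smul_apply, smul_eq_mul] at h1 h2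
  simp only [bracket, det3_eq, PiLp.sub_apply]
  constructor
  · linear_combination -h1
  · linear_combination h2

theorem IsRegularDirection.crossing {p : Fin 5 → E3} {ξ : E3} (hξ : IsRegularDirection p ξ)
    {i j k l : Fin 5} (hij : p i ≠ p j) {s t h : ℝ}
    (ht : t ∈ Set.Ioo (0 : ℝ) 1) (h0 : h ≠ 0)
    (hh : AffineMap.lineMap (p i) (p j) s - AffineMap.lineMap (p k) (p l) t = h • ξ) :
    bracket ξ (p i) (p j) (p k) * bracket ξ (p i) (p j) (p l) < 0 ∧
      t = bracket ξ (p i) (p j) (p k) /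
        (bracket ξ (p i) (p j) (p k) - bracket ξ (p i) (p j) (p l)) := by
  have hb := (bracket_lineMap_sub hh).1
  -- Otherwise both brackets vanish, all four vertices lie on one line, and the height `h` would be
  -- zero.
  have hne : bracket ξ (p i) (p j) (p k) ≠ 0 := by
    intro hk
    have hl : bracket ξ (p i) (p j) (p l) = 0 := by
      rw [hk, mul_zero, zero_add] at hb
      exact (mul_eq_zero.1 hb).resolve_left ht.1.ne'
    have hu : p j - p i ≠ 0 := fun h => hij (sub_eq_zero.1 h).symm
    obtain ⟨c, hc⟩ := exists_smul_of_cross_eq_zero hu (hξ.cross_eq_zero i j k hk)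
    obtain ⟨d, hd⟩ := exists_smul_of_cross_eq_zero hu (hξ.cross_eq_zero i j l hl)
    have hsum : h • ξ = (s - (1 - t) * c - t * d) • (p j - p i) := by
      have : h • ξ = s • (p j - p i) - (1 - t) • (p k - p i) - t • (p l - p i) := by
        rw [← hh, AffineMap.lineMap_apply_module', AffineMap.lineMap_apply_module']; module
      rw [this, hc, hd]; module
    refine h0 (hξ.height_eq_zero hij (c := 0) ?_)
    rw [hsum]
    simp [cross]
  have hneg := mul_neg_of_convex_comb ht hne hb
  refine ⟨hneg, ?_⟩
  rw [eq_div_iff]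
  · linear_combination -hb
  · intro h
    rw [sub_eq_zero.1 h] at hneg
    nlinarith

theorem div_sub_mem_Ioo {x y : ℝ} (h : x * y < 0) : x / (x - y) ∈ Set.Ioo (0 : ℝ) 1 := by
  rcases mul_neg_iff.1 h with ⟨hx, hy⟩ | ⟨hx, hy⟩
  · have : 0 < x - y := by linarith
    exact ⟨by positivity, by rw [div_lt_one this]; linarith⟩
  · have : x - y < 0 := by linarith
    exact ⟨div_pos_of_neg_of_neg hx this, by rw [div_lt_one_of_neg this]; linarith⟩

/-- The difference of the two points is coplanar with `ξ` and each of the two edge vectors. By `h`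
these vectors and `ξ` are independent, so Cramer's rule leaves a multiple of `ξ`. -/
theorem exists_sub_eq_of_bracket {ξ a b c d : E3} {s t : ℝ}
    (h : bracket ξ a b c ≠ bracket ξ a b d)
    (ht : (1 - t) * bracket ξ a b c + t * bracket ξ a b d = 0)
    (hs : (1 - s) * bracket ξ c d a + s * bracket ξ c d b = 0) :
    ∃ h : ℝ, AffineMap.lineMap a b s - AffineMap.lineMap c d t = h • ξ := by
  set x : E3 := AffineMap.lineMap a b s - AffineMap.lineMap c d t with hx
  have h1 : det3 (b - a) x ξ = 0 := by
    rw [hx]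
    simp only [AffineMap.lineMap_apply_module', det3_eq, PiLp.sub_apply, PiLp.add_apply,
      PiLp.smul_apply, smul_eq_mul]
    simp only [bracket, det3_eq, PiLp.sub_apply] at ht
    linear_combination -ht
  have h2 : det3 (d - c) x ξ = 0 := by
    rw [hx]
    simp only [AffineMap.lineMap_apply_module', det3_eq, PiLp.sub_apply, PiLp.add_apply,
      PiLp.smul_apply, smul_eq_mul]
    simp only [bracket, det3_eq, PiLp.sub_apply] at hs
    linear_combination hs
  have hD : det3 (b - a) (d - c) ξ ≠ 0 := by
    intro h0
    apply h
    have : bracket ξ a b d - bracket ξ a b c = det3 (b - a) (d - c) ξ := by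
      simp only [bracket, det3_eq, PiLp.sub_apply]; ring
    linarith
  refine ⟨det3 (b - a) (d - c) x / det3 (b - a) (d - c) ξ, ?_⟩
  have hc := det3_cramer (b - a) (d - c) x ξ
  have h3 : det3 (d - c) x ξ = 0 := h2
  rw [h3, h1, zero_smul, zero_smul, sub_zero, zero_add] at hc
  rw [div_eq_inv_mul, mul_smul, ← sub_eq_zero.1 hc, smul_smul, inv_mul_cancel₀ hD, one_smul]

/-! ### Simple chains -/

namespace IsSimpleChain

variable {p : Fin 5 → E3} (hp : IsSimpleChain (n := 4) p) {ξ : E3}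
include hp

theorem ne (i : Fin 4) : p i.castSucc ≠ p i.succ := by
  intro h
  have := hp (i, 0) (i, 1) (by simp) (by simp) (by simp [chainPoint, h])
  simp at this

theorem eq_of_interior {x y : Fin 4 × ℝ} (hx : x.2 ∈ Set.Ioo (0 : ℝ) 1)
    (hy : y.2 ∈ Set.Ioo (0 : ℝ) 1) (h : chainPoint p x = chainPoint p y) : x = y := by
  have h := hp x y (Set.Ioo_subset_Icc_self hx) (Set.Ioo_subset_Icc_self hy) h
  obtain ⟨i, s⟩ := x
  obtain ⟨j, t⟩ := y
  simp only [Set.mem_Ioo] at hx hy h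
  have h1 : (i : ℝ) < (j : ℝ) + 1 := by linarith
  have h2 : (j : ℝ) < (i : ℝ) + 1 := by linarith
  have hij : i = j := by
    apply Fin.ext
    have h1' : (i : ℕ) < (j : ℕ) + 1 := by exact_mod_cast h1
    have h2' : (j : ℕ) < (i : ℕ) + 1 := by exact_mod_cast h2
    omega
  subst hij
  simp only [Prod.mk.injEq, true_and]
  linarith

theorem height_ne {x y : Fin 4 × ℝ} (h : CrossAt p ξ x y) :
    (inner ℝ (chainPoint p x) ξ : ℝ) ≠ inner ℝ (chainPoint p y) ξ := by
  intro heq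
  refine h.1 (eq_of_interior hp h.2.1 h.2.2.1 ?_)
  have := h.2.2.2
  rw [proj, proj, heq] at this
  exact sub_left_injective this

end IsSimpleChain

theorem CrossAt.symm {n : ℕ} {p : Fin (n + 1) → E3} {ξ : E3} {x y : Fin n × ℝ}
    (h : CrossAt p ξ x y) : CrossAt p ξ y x := ⟨h.1.symm, h.2.2.1, h.2.1, h.2.2.2.symm⟩

theorem positiveAt_comm {n : ℕ} {p : Fin (n + 1) → E3} {ξ : E3} {x y : Fin n × ℝ} :
    PositiveAt p ξ x y ↔ PositiveAt p ξ y x := by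
  unfold PositiveAt
  have : cross (edgeVec p y.1) (edgeVec p x.1) = -cross (edgeVec p x.1) (edgeVec p y.1) := by
    apply E3.ext <;> simp [cross_coord] <;> ring
  rw [this, inner_neg_left]
  constructor <;> intro h <;> linarith

/-! ### Crossings of edges as sign conditions on brackets -/

section Crossing

variable {p : Fin 5 → E3} {ξ : E3}

/-- The bracket of three vertices. -/
noncomputable abbrev vbr (p : Fin 5 → E3) (ξ : E3) (i j k : Fin 5) : ℝ :=
  bracket ξ (p i) (p j) (p k)

/-- Two projected edges cross if the line of each separates the endpoints of the other; the
parameters are the zeros of the affine functions given by the brackets. -/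
theorem crossAt_iff (hp : IsSimpleChain (n := 4) p) (hξ : IsRegularDirection p ξ) {i j : Fin 4}
    (hij : i ≠ j) {s t : ℝ} :
    CrossAt p ξ (i, s) (j, t) ↔
      vbr p ξ i.castSucc i.succ j.castSucc * vbr p ξ i.castSucc i.succ j.succ < 0 ∧
      vbr p ξ j.castSucc j.succ i.castSucc * vbr p ξ j.castSucc j.succ i.succ < 0 ∧
      s = vbr p ξ j.castSucc j.succ i.castSucc /
        (vbr p ξ j.castSucc j.succ i.castSucc - vbr p ξ j.castSucc j.succ i.succ) ∧
      t = vbr p ξ i.castSucc i.succ j.castSucc /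
        (vbr p ξ i.castSucc i.succ j.castSucc - vbr p ξ i.castSucc i.succ j.succ) := by
  constructor
  · intro h
    obtain ⟨k, hk⟩ := (proj_eq_proj_iff hξ.norm_eq _ _).1 h.2.2.2
    have hk0 : k ≠ 0 := by
      rintro rfl
      rw [zero_smul, sub_eq_zero] at hk
      exact h.1 (hp.eq_of_interior h.2.1 h.2.2.1 hk)
    have h1 := hξ.crossing (hp.ne i) h.2.2.1 hk0 hk
    have hk' : chainPoint p (j, t) - chainPoint p (i, s) = (-k) • ξ := by
      rw [neg_smul, ← hk]; abel
    have h2 := hξ.crossing (hp.ne j) h.2.1 (neg_ne_zero.2 hk0) hk'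
    exact ⟨h1.1, h2.1, h2.2, h1.2⟩
  · rintro ⟨h1, h2, hs, ht⟩
    refine ⟨fun h => hij (congrArg Prod.fst h), hs ▸ div_sub_mem_Ioo h2, ht ▸ div_sub_mem_Ioo h1,
      (proj_eq_proj_iff hξ.norm_eq _ _).2 (exists_sub_eq_of_bracket ?_ ?_ ?_)⟩
    · intro h
      simp only [vbr] at h1
      rw [h] at h1
      nlinarith
    · have : vbr p ξ i.castSucc i.succ j.castSucc - vbr p ξ i.castSucc i.succ j.succ ≠ 0 := by
        intro h
        rw [sub_eq_zero.1 h] at h1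
        nlinarith
      rw [eq_div_iff this] at ht
      simp only [vbr] at ht
      linear_combination -ht
    · have : vbr p ξ j.castSucc j.succ i.castSucc - vbr p ξ j.castSucc j.succ i.succ ≠ 0 := by
        intro h
        rw [sub_eq_zero.1 h] at h2
        nlinarith
      rw [eq_div_iff this] at hs
      simp only [vbr] at hs
      linear_combination -hs

theorem CrossAt.nonadjacent (hp : IsSimpleChain (n := 4) p) (hξ : IsRegularDirection p ξ)
    {x y : Fin 4 × ℝ} (h : CrossAt p ξ x y) :
    (x.1 : ℕ) + 2 ≤ y.1 ∨ (y.1 : ℕ) + 2 ≤ x.1 := by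
  have hadj : ∀ {x y : Fin 4 × ℝ}, CrossAt p ξ x y → (y.1 : ℕ) ≠ (x.1 : ℕ) + 1 := by
    rintro ⟨i, s⟩ ⟨j, t⟩ h hij
    have hji : j.castSucc = i.succ := Fin.ext (by simpa using hij)
    have h1 := h.2.2.2
    simp only [chainPoint, hji] at h1
    refine h.1 (hp.eq_of_interior h.2.1 h.2.2.1 ?_)
    simp only [chainPoint, hji]
    exact hξ.adjacent (hji ▸ hp.ne i) h.2.2.1 h1
  have h1 := hadj h
  have h2 := hadj h.symm
  have h3 : (x.1 : ℕ) ≠ y.1 := by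
    intro hxy
    obtain ⟨i, s⟩ := x
    obtain ⟨j, t⟩ := y
    obtain rfl : i = j := Fin.ext hxy
    exact h.1 (Prod.ext rfl (hξ.param_eq (hp.ne i) h.2.2.2))
  omega

theorem IsRegularDirection.isGeneric (hp : IsSimpleChain (n := 4) p)
    (hξ : IsRegularDirection p ξ) : IsGeneric (n := 4) p ξ := by
  constructor
  · rintro ⟨i, s⟩ ⟨j, t⟩ hs ht h
    have hs' : s ∈ Set.Icc (0 : ℝ) 1 := by rcases hs with rfl | rfl <;> simp
    refine hp (i, s) (j, t) hs' ht ?_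
    have hv : ∃ k, chainPoint (n := 4) p (i, s) = p k := by
      rcases hs with rfl | rfl
      · exact ⟨i.castSucc, by simp [chainPoint]⟩
      · exact ⟨i.succ, by simp [chainPoint]⟩
    obtain ⟨k, hk⟩ := hv
    rw [hk] at h ⊢
    exact hξ.vertex_eq (hp.ne j) h
  · intro x y z hx hy hz hxy hyz
    by_contra! hne
    -- Among four consecutive edges there are no three that are pairwise nonadjacent, so triple
    -- points cannot occur.
    have h1 := CrossAt.nonadjacent hp hξ (show CrossAt p ξ x y from ⟨hne.1, hx, hy, hxy⟩)
    have h2 := CrossAt.nonadjacent hp hξ (show CrossAt p ξ y z from ⟨hne.2.1, hy, hz, hyz⟩)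
    have h3 := CrossAt.nonadjacent hp hξ
      (show CrossAt p ξ x z from ⟨hne.2.2, hx, hz, hxy.trans hyz⟩)
    have := x.1.isLt
    have := y.1.isLt
    have := z.1.isLt
    omega

end Crossing

/-! ### Relations between the brackets of five points -/

/-- The relations between the nine brackets (up to sign) that occur in the conditions for crossings,
and the coefficients of the affine relation between the five points. -/
structure BracketRel (n₁ n₂ n₃ n₄ u₁ u₂ u₃ v₂ v₃ c₀ c₁ c₂ c₃ c₄ : ℝ) : Prop where
  n_sum : n₁ + n₃ = n₂ + n₄
  u_sum : u₁ + u₃ = u₂ - n₂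
  v_sum : v₃ - u₃ = v₂ + n₃
  plucker₃ : n₁ * u₃ - n₃ * u₁ = n₂ * v₃
  plucker₁ : u₂ * n₃ = n₄ * u₃ - n₂ * v₂
  rel₀₁ : -c₂ * n₄ + c₃ * n₂ + c₄ * u₂ = 0
  rel₂₃ : c₀ * n₁ - c₁ * n₃ - c₄ * v₃ = 0
  rel₃₄ : c₀ * u₁ - c₁ * u₃ - c₂ * v₃ = 0
  rel₁₄ : c₀ * u₂ - c₂ * v₂ + c₃ * u₃ = 0
  rel₀₃ : -c₁ * n₂ - c₂ * n₁ + c₄ * u₁ = 0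
  rel₁₂ : -c₀ * n₄ - c₃ * n₃ + c₄ * v₂ = 0

namespace BracketRel

variable {n₁ n₂ n₃ n₄ u₁ u₂ u₃ v₂ v₃ c₀ c₁ c₂ c₃ c₄ : ℝ}

/-- Passing from `ξ` to `-ξ` negates all brackets and keeps the volumes. -/
theorem neg (h : BracketRel n₁ n₂ n₃ n₄ u₁ u₂ u₃ v₂ v₃ c₀ c₁ c₂ c₃ c₄) :
    BracketRel (-n₁) (-n₂) (-n₃) (-n₄) (-u₁) (-u₂) (-u₃) (-v₂) (-v₃) c₀ c₁ c₂ c₃ c₄ where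
  n_sum := by linear_combination -h.n_sum
  u_sum := by linear_combination -h.u_sum
  v_sum := by linear_combination -h.v_sum
  plucker₃ := by linear_combination h.plucker₃
  plucker₁ := by linear_combination h.plucker₁
  rel₀₁ := by linear_combination -h.rel₀₁
  rel₂₃ := by linear_combination -h.rel₂₃
  rel₃₄ := by linear_combination -h.rel₃₄
  rel₁₄ := by linear_combination -h.rel₁₄
  rel₀₃ := by linear_combination -h.rel₀₃
  rel₁₂ := by linear_combination -h.rel₁₂

/-- Reflection in the plane of projection negates the volumes and keeps the brackets. -/
theorem neg_coeff (h : BracketRel n₁ n₂ n₃ n₄ u₁ u₂ u₃ v₂ v₃ c₀ c₁ c₂ c₃ c₄) :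
    BracketRel n₁ n₂ n₃ n₄ u₁ u₂ u₃ v₂ v₃ (-c₀) (-c₁) (-c₂) (-c₃) (-c₄) where
  n_sum := h.n_sum
  u_sum := h.u_sum
  v_sum := h.v_sum
  plucker₃ := h.plucker₃
  plucker₁ := h.plucker₁
  rel₀₁ := by linear_combination -h.rel₀₁
  rel₂₃ := by linear_combination -h.rel₂₃
  rel₃₄ := by linear_combination -h.rel₃₄
  rel₁₄ := by linear_combination -h.rel₁₄
  rel₀₃ := by linear_combination -h.rel₀₃
  rel₁₂ := by linear_combination -h.rel₁₂

theorem coeff_sign_of_pos (h : BracketRel n₁ n₂ n₃ n₄ u₁ u₂ u₃ v₂ v₃ c₀ c₁ c₂ c₃ c₄)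
    (h1 : 0 < n₁) (h2 : 0 < n₂) (h3 : 0 < n₃) (h4 : 0 < n₄) (hu1 : u₁ < 0) (hu2 : u₂ < 0)
    (hu3 : u₃ < 0) (hv3 : 0 < v₃) (hc2 : 0 < c₂) (hc4 : 0 < c₄) :
    0 < c₃ ∧ c₀ < 0 ∧ c₁ < 0 := by
  have e3 : 0 < c₃ * n₂ := by
    nlinarith [h.rel₀₁, mul_pos hc2 h4, mul_pos hc4 (neg_pos.2 hu2)]
  have e1 : 0 < -c₁ * n₂ := by
    nlinarith [h.rel₀₃, mul_pos hc2 h1, mul_pos hc4 (neg_pos.2 hu1)]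
  have e0 : 0 < -c₀ * n₂ * v₃ := by
    -- Eliminating `c₁` from `rel₂₃` and `rel₃₄` leaves `c₀` with the coefficient `n₁ * u₃ - n₃ *
    -- u₁`, which is `n₂ * v₃` by Plücker's relation.
    have : -c₀ * n₂ * v₃ = v₃ * (c₂ * n₃ + c₄ * (-u₃)) := by
      linear_combination c₀ * h.plucker₃ - u₃ * h.rel₂₃ + n₃ * h.rel₃₄
    rw [this]
    have := neg_pos.2 hu3
    positivity
  refine ⟨pos_of_mul_pos_left e3 h2.le, ?_, ?_⟩
  · have := pos_of_mul_pos_left (pos_of_mul_pos_left e0 hv3.le) h2.le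
    linarith
  · have := pos_of_mul_pos_left e1 h2.le
    linarith

/-- With the Radon signs known, each of `rel₁₄`, `rel₃₄`, `rel₀₃`, `rel₂₃`, `rel₁₂` contains one
bracket of unknown sign when taken in this order, so the signs propagate. -/
theorem of_polygon (h : BracketRel n₁ n₂ n₃ n₄ u₁ u₂ u₃ v₂ v₃ c₀ c₁ c₂ c₃ c₄)
    (hc0 : c₀ < 0) (hc1 : c₁ < 0) (hc2 : 0 < c₂) (hc3 : 0 < c₃) (hc4 : 0 < c₄)
    (h1 : 0 < n₁) (hu2 : u₂ < 0) (hv2 : v₂ < 0) (hv3 : 0 < v₃) :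
    0 < n₂ ∧ 0 < n₃ ∧ 0 < n₄ ∧ u₁ < 0 ∧ u₃ < 0 := by
  have hu3 : u₃ < 0 := by
    have : 0 < c₃ * (-u₃) := by
      nlinarith [h.rel₁₄, mul_pos hc2 (neg_pos.2 hv2), mul_pos (neg_pos.2 hc0) (neg_pos.2 hu2)]
    linarith [pos_of_mul_pos_right this hc3.le]
  have hu1 : u₁ < 0 := by
    have : 0 < -c₀ * (-u₁) := by
      nlinarith [h.rel₃₄, mul_pos hc2 hv3, mul_pos (neg_pos.2 hc1) (neg_pos.2 hu3)]
    linarith [pos_of_mul_pos_right this (neg_pos.2 hc0).le]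
  have h2 : 0 < n₂ := by
    have : 0 < -c₁ * n₂ := by
      nlinarith [h.rel₀₃, mul_pos hc2 h1, mul_pos hc4 (neg_pos.2 hu1)]
    exact pos_of_mul_pos_right this (neg_pos.2 hc1).le
  have h3 : 0 < n₃ := by
    have : 0 < -c₁ * n₃ := by
      nlinarith [h.rel₂₃, mul_pos (neg_pos.2 hc0) h1, mul_pos hc4 hv3]
    exact pos_of_mul_pos_right this (neg_pos.2 hc1).le
  have h4 : 0 < n₄ := by
    have : 0 < -c₀ * n₄ := by
      nlinarith [h.rel₁₂, mul_pos hc3 h3, mul_pos hc4 (neg_pos.2 hv2)]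
    exact pos_of_mul_pos_right this (neg_pos.2 hc0).le
  exact ⟨h2, h3, h4, hu1, hu3⟩

/-- Eliminating `n₃` from `rel₂₃` through `v_sum` writes `-c₀ * n₁` as a sum of terms that are
nonnegative as soon as `c₄ + c₁ ≤ 0`. This is why the fourth side of the polygon disappears for `c₄₁
≤ 0`. -/
theorem n₁_pos_of_triangle (h : BracketRel n₁ n₂ n₃ n₄ u₁ u₂ u₃ v₂ v₃ c₀ c₁ c₂ c₃ c₄)
    (hc0 : c₀ < 0) (hc1 : c₁ < 0) (hc2 : 0 < c₂) (hc3 : 0 < c₃) (hc : c₄ + c₁ ≤ 0)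
    (hu2 : u₂ < 0) (hv2 : v₂ < 0) (hv3 : 0 < v₃) : 0 < n₁ := by
  have hu3 : u₃ < 0 := by
    have : 0 < c₃ * (-u₃) := by
      nlinarith [h.rel₁₄, mul_pos hc2 (neg_pos.2 hv2), mul_pos (neg_pos.2 hc0) (neg_pos.2 hu2)]
    linarith [pos_of_mul_pos_right this hc3.le]
  have : 0 < -c₀ * n₁ := by
    have e : -c₀ * n₁ = -(c₄ + c₁) * v₃ + -c₁ * (-v₂) + -c₁ * (-u₃) := by
      linear_combination -h.rel₂₃ + c₁ * h.v_sum
    rw [e]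
    have e1 := mul_pos (neg_pos.2 hc1) (neg_pos.2 hv2)
    have e2 := mul_pos (neg_pos.2 hc1) (neg_pos.2 hu3)
    have e3 := mul_nonneg (neg_nonneg.2 hc) hv3.le
    linarith
  exact pos_of_mul_pos_right this (neg_pos.2 hc0).le

/-- The signs of the brackets in a diagram in which `e₁` crosses `e₃` and `e₄`, for one of the two
orientations. -/
theorem signs_of_cross (h : BracketRel n₁ n₂ n₃ n₄ u₁ u₂ u₃ v₂ v₃ c₀ c₁ c₂ c₃ c₄)
    (h2 : 0 < n₂) (h24 : 0 < n₂ * n₄) (h13 : 0 < n₁ * n₃) (hu2 : n₂ * u₂ < 0)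
    (hu13 : 0 < u₁ * u₃) : 0 < n₁ ∧ 0 < n₃ ∧ 0 < n₄ ∧ u₁ < 0 ∧ u₂ < 0 ∧ u₃ < 0 := by
  have h4 := pos_of_mul_pos_right h24 h2.le
  have hu2' : u₂ < 0 := by
    by_contra hc
    have := mul_nonneg h2.le (not_lt.1 hc)
    linarith
  have hn := h.n_sum
  have hu := h.u_sum
  rcases pos_and_pos_or_neg_and_neg_of_mul_pos h13 with ⟨ha, hb⟩ | ⟨ha, hb⟩
  · rcases pos_and_pos_or_neg_and_neg_of_mul_pos hu13 with ⟨hc, hd⟩ | ⟨hc, hd⟩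
    · linarith
    · exact ⟨ha, hb, h4, hc, hu2', hd⟩
  · linarith

/-- A diagram B(i) forces the Radon partition of a piercing: `neg` reduces to `0 < n₂` and
`neg_coeff` to `0 < c₂`. -/
theorem coeff_sign (h : BracketRel n₁ n₂ n₃ n₄ u₁ u₂ u₃ v₂ v₃ c₀ c₁ c₂ c₃ c₄)
    (h24 : 0 < n₂ * n₄) (h13 : 0 < n₁ * n₃) (hu2 : n₂ * u₂ < 0) (hu13 : 0 < u₁ * u₃)
    (hv3 : 0 < n₂ * v₃) (hc : 0 < c₂ * c₄) : 0 < c₂ * c₃ ∧ 0 < c₀ * c₁ := by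
  have base : ∀ {n₁ n₂ n₃ n₄ u₁ u₂ u₃ v₂ v₃ c₀ c₁ c₂ c₃ c₄ : ℝ},
      BracketRel n₁ n₂ n₃ n₄ u₁ u₂ u₃ v₂ v₃ c₀ c₁ c₂ c₃ c₄ → 0 < n₂ → 0 < n₂ * n₄ → 0 < n₁ * n₃ →
      n₂ * u₂ < 0 → 0 < u₁ * u₃ → 0 < n₂ * v₃ → 0 < c₂ * c₄ → 0 < c₂ * c₃ ∧ 0 < c₀ * c₁ := by
    intro n₁ n₂ n₃ n₄ u₁ u₂ u₃ v₂ v₃ c₀ c₁ c₂ c₃ c₄ h hn2 h24 h13 hu2 hu13 hv3 hc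
    obtain ⟨h1, h3, h4, hu1, hu2', hu3⟩ := h.signs_of_cross hn2 h24 h13 hu2 hu13
    have hv3' := pos_of_mul_pos_right hv3 hn2.le
    rcases pos_and_pos_or_neg_and_neg_of_mul_pos hc with ⟨ha, hb⟩ | ⟨ha, hb⟩
    · obtain ⟨e3, e0, e1⟩ := h.coeff_sign_of_pos h1 hn2 h3 h4 hu1 hu2' hu3 hv3' ha hb
      exact ⟨mul_pos ha e3, mul_pos_of_neg_of_neg e0 e1⟩
    · obtain ⟨e3, e0, e1⟩ := h.neg_coeff.coeff_sign_of_pos h1 hn2 h3 h4 hu1 hu2' hu3 hv3'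
        (neg_pos.2 ha) (neg_pos.2 hb)
      exact ⟨mul_pos_of_neg_of_neg ha (neg_pos.1 e3), mul_pos (neg_lt_zero.1 e0) (neg_lt_zero.1 e1)⟩
  have hn2 : n₂ ≠ 0 := by rintro rfl; simp at h24
  rcases lt_or_gt_of_ne hn2 with hn | hn
  · exact base h.neg (neg_pos.2 hn) (by linarith) (by linarith) (by linarith) (by linarith)
      (by linarith) hc
  · exact base h hn h24 h13 hu2 hu13 hv3 hc

/-- The region of the directions with a diagram of the first kind. -/
theorem region_iff (h : BracketRel n₁ n₂ n₃ n₄ u₁ u₂ u₃ v₂ v₃ c₀ c₁ c₂ c₃ c₄)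
    (hv2 : v₂ ≠ 0) (h42 : 0 < c₂ * c₄) (h23 : 0 < c₂ * c₃) (h01 : 0 < c₀ * c₁)
    (hsum : c₀ + c₁ + c₂ + c₃ + c₄ = 0) :
    (0 < n₂ * n₄ ∧ 0 < n₁ * n₃ ∧ n₂ * u₂ < 0 ∧ 0 < u₁ * u₃ ∧ 0 < n₂ * v₃ ∧
        ¬(0 < n₃ * v₂ ∧ u₃ * v₃ < 0)) ↔
      (0 < n₁ ∧ u₂ < 0 ∧ v₂ < 0 ∧ 0 < v₃) ∨ (n₁ < 0 ∧ 0 < u₂ ∧ 0 < v₂ ∧ v₃ < 0) := by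
  have fwd : ∀ {n₁ n₂ n₃ n₄ u₁ u₂ u₃ v₂ v₃ : ℝ},
      BracketRel n₁ n₂ n₃ n₄ u₁ u₂ u₃ v₂ v₃ c₀ c₁ c₂ c₃ c₄ → v₂ ≠ 0 → 0 < n₂ →
      (0 < n₂ * n₄ ∧ 0 < n₁ * n₃ ∧ n₂ * u₂ < 0 ∧ 0 < u₁ * u₃ ∧ 0 < n₂ * v₃ ∧
        ¬(0 < n₃ * v₂ ∧ u₃ * v₃ < 0)) → 0 < n₁ ∧ u₂ < 0 ∧ v₂ < 0 ∧ 0 < v₃ := by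
    rintro n₁ n₂ n₃ n₄ u₁ u₂ u₃ v₂ v₃ h hv2 hn ⟨h24, h13, hu2, hu13, hv3, hnot⟩
    obtain ⟨h1, h3, h4, hu1, hu2', hu3⟩ := h.signs_of_cross hn h24 h13 hu2 hu13
    have hv3' := pos_of_mul_pos_right hv3 hn.le
    refine ⟨h1, hu2', ?_, hv3'⟩
    -- With `v₂` positive, `e₂` and `e₄` would cross.
    by_contra hc
    exact hnot ⟨mul_pos h3 (lt_of_le_of_ne (not_lt.1 hc) hv2.symm), mul_neg_of_neg_of_pos hu3 hv3'⟩
  have bwd : ∀ {n₁ n₂ n₃ n₄ u₁ u₂ u₃ v₂ v₃ : ℝ},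
      BracketRel n₁ n₂ n₃ n₄ u₁ u₂ u₃ v₂ v₃ c₀ c₁ c₂ c₃ c₄ →
      0 < n₁ ∧ u₂ < 0 ∧ v₂ < 0 ∧ 0 < v₃ →
      (0 < n₂ * n₄ ∧ 0 < n₁ * n₃ ∧ n₂ * u₂ < 0 ∧ 0 < u₁ * u₃ ∧ 0 < n₂ * v₃ ∧
        ¬(0 < n₃ * v₂ ∧ u₃ * v₃ < 0)) := by
    rintro n₁ n₂ n₃ n₄ u₁ u₂ u₃ v₂ v₃ h ⟨h1, hu2, hv2, hv3⟩
    have key : 0 < n₂ ∧ 0 < n₃ ∧ 0 < n₄ ∧ u₁ < 0 ∧ u₃ < 0 := by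
      rcases pos_and_pos_or_neg_and_neg_of_mul_pos h42 with ⟨h2, h4⟩ | ⟨h2, h4⟩
      · have h3 := pos_of_mul_pos_right h23 h2.le
        rcases pos_and_pos_or_neg_and_neg_of_mul_pos h01 with ⟨h0, h1'⟩ | ⟨h0, h1'⟩
        · linarith
        · exact h.of_polygon h0 h1' h2 h3 h4 h1 hu2 hv2 hv3
      · have h3 : c₃ < 0 := by
          rcases pos_and_pos_or_neg_and_neg_of_mul_pos h23 with ⟨h2', _⟩ | ⟨_, h3⟩
          · linarith
          · exact h3
        rcases pos_and_pos_or_neg_and_neg_of_mul_pos h01 with ⟨h0, h1'⟩ | ⟨h0, h1'⟩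
        · exact h.neg_coeff.of_polygon (neg_lt_zero.2 h0) (neg_lt_zero.2 h1') (neg_pos.2 h2)
            (neg_pos.2 h3) (neg_pos.2 h4) h1 hu2 hv2 hv3
        · linarith
    obtain ⟨h2, h3, h4, hu1, hu3⟩ := key
    exact ⟨mul_pos h2 h4, mul_pos h1 h3, mul_neg_of_pos_of_neg h2 hu2,
      mul_pos_of_neg_of_neg hu1 hu3, mul_pos h2 hv3, fun hn => absurd hn.1
        (not_lt.2 (mul_nonpos_of_nonneg_of_nonpos h3.le hv2.le))⟩
  constructor
  · intro hq
    have hn2 : n₂ ≠ 0 := by rintro rfl; simp at hq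
    rcases lt_or_gt_of_ne hn2 with hn | hn
    · right
      have := fwd h.neg (neg_ne_zero.2 hv2) (neg_pos.2 hn)
        (by simpa only [neg_mul_neg] using hq)
      exact ⟨by linarith [this.1], by linarith [this.2.1], by linarith [this.2.2.1],
        by linarith [this.2.2.2]⟩
    · exact Or.inl (fwd h hv2 hn hq)
  · rintro (hq | ⟨h1, h2, h3, h4⟩)
    · exact bwd h hq
    · have := bwd h.neg ⟨neg_pos.2 h1, neg_lt_zero.2 h2, neg_lt_zero.2 h3, neg_pos.2 h4⟩
      simpa only [neg_mul_neg] using this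

theorem div_lt_div_iff_of_mul_neg {x y a b : ℝ} (h : a * b < 0) :
    x / a < y / b ↔ y * a < x * b := by
  have ha : a ≠ 0 := by rintro rfl; simp at h
  have hb : b ≠ 0 := by rintro rfl; simp at h
  rw [← sub_neg, ← sub_pos (a := x * b), div_sub_div _ _ ha hb, div_neg_iff]
  constructor
  · rintro (⟨h1, _⟩ | ⟨_, h2⟩) <;> nlinarith
  · intro h1; exact Or.inl ⟨by linarith, h⟩

/-- The order of the crossings of `e₁` with `e₃` and `e₄`. -/
theorem order_iff (h : BracketRel n₁ n₂ n₃ n₄ u₁ u₂ u₃ v₂ v₃ c₀ c₁ c₂ c₃ c₄)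
    (h24 : 0 < n₂ * n₄) (hu2 : n₂ * u₂ < 0) :
    n₁ / (n₁ + n₃) < u₁ / (u₁ + u₃) ↔ 0 < n₂ * v₃ := by
  -- The denominators are `n₂ + n₄` and `u₂ - n₂`, of opposite signs. After cross-multiplication the
  -- comparison is the sign of `n₁ * u₃ - n₃ * u₁ = n₂ * v₃`.
  have hneg : (n₁ + n₃) * (u₁ + u₃) < 0 := by
    rw [h.n_sum, h.u_sum]
    have hn2 : n₂ ≠ 0 := by rintro rfl; simp at h24
    rcases lt_or_gt_of_ne hn2 with hn | hn
    · have h4 : n₄ < 0 := by nlinarith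
      have h2 : 0 < u₂ := by nlinarith
      exact mul_neg_of_neg_of_pos (by linarith) (by linarith)
    · have h4 : 0 < n₄ := by nlinarith
      have h2 : u₂ < 0 := by nlinarith
      exact mul_neg_of_pos_of_neg (by linarith) (by linarith)
  rw [div_lt_div_iff_of_mul_neg hneg]
  have := h.plucker₃
  constructor <;> intro h' <;> nlinarith

/-- If `e₁` crosses `e₃` and `e₂` crosses `e₄` then `e₁` crosses `e₄`, and the order of the
crossings is determined. -/
theorem cross_of_cross (h : BracketRel n₁ n₂ n₃ n₄ u₁ u₂ u₃ v₂ v₃ c₀ c₁ c₂ c₃ c₄)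
    (h24 : 0 < n₂ * n₄) (h13 : 0 < n₁ * n₃) (hv2 : 0 < n₃ * v₂) (hv3 : u₃ * v₃ < 0) :
    n₂ * u₂ < 0 ∧ 0 < u₁ * u₃ ∧ 0 < n₂ * v₃ ∧ n₂ / (n₂ - u₂) < n₃ / (n₃ + v₂) := by
  have base : ∀ {n₁ n₂ n₃ n₄ u₁ u₂ u₃ v₂ v₃ : ℝ},
      BracketRel n₁ n₂ n₃ n₄ u₁ u₂ u₃ v₂ v₃ c₀ c₁ c₂ c₃ c₄ → 0 < n₂ → 0 < n₂ * n₄ → 0 < n₁ * n₃ →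
      0 < n₃ * v₂ → u₃ * v₃ < 0 →
      n₂ * u₂ < 0 ∧ 0 < u₁ * u₃ ∧ 0 < n₂ * v₃ ∧ n₂ / (n₂ - u₂) < n₃ / (n₃ + v₂) := by
    intro n₁ n₂ n₃ n₄ u₁ u₂ u₃ v₂ v₃ h h2 h24 h13 hv2 hv3
    have h4 := pos_of_mul_pos_right h24 h2.le
    have hn := h.n_sum
    have hv := h.v_sum
    rcases pos_and_pos_or_neg_and_neg_of_mul_pos h13 with ⟨h1, h3⟩ | ⟨h1, h3⟩
    swap
    · linarith
    have hv2' := pos_of_mul_pos_right hv2 h3.le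
    -- The case `u₃ > 0 > v₃` contradicts `v_sum`, whose right side `v₂ + n₃` is positive.
    rcases mul_neg_iff.1 hv3 with ⟨hu3, hv3'⟩ | ⟨hu3, hv3'⟩
    · linarith
    have hu1 : u₁ < 0 := by
      have : n₃ * u₁ < 0 := by
        nlinarith [h.plucker₃, mul_neg_of_pos_of_neg h1 hu3, mul_pos h2 hv3']
      nlinarith
    have hu2 : u₂ < 0 := by
      have : n₃ * u₂ < 0 := by
        nlinarith [h.plucker₁, mul_neg_of_pos_of_neg h4 hu3, mul_pos h2 hv2']
      nlinarith
    refine ⟨mul_neg_of_pos_of_neg h2 hu2, mul_pos_of_neg_of_neg hu1 hu3, mul_pos h2 hv3', ?_⟩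
    rw [div_lt_div_iff₀ (by linarith) (by linarith)]
    nlinarith [h.plucker₁, mul_neg_of_pos_of_neg h4 hu3]
  have hn2 : n₂ ≠ 0 := by rintro rfl; simp at h24
  rcases lt_or_gt_of_ne hn2 with hn | hn
  · have := base h.neg (neg_pos.2 hn) (by linarith) (by linarith) (by linarith) (by linarith)
    simpa only [neg_mul_neg, ← neg_sub', ← neg_add, neg_div_neg_eq] using this
  · exact base h hn h24 h13 hv2 hv3

end BracketRel

/-! ### Brackets of the vertices of a chain -/

section Five

variable (p : Fin 5 → E3) (ξ : E3)

/-- The signs make each of `nᵢ`, `uᵢ`, `vᵢ` the inner product of `ξ` with the unnormalized normal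
vector of the same name. The Plücker relations are seen from `p 3` and `p 1`, and `relᵢⱼ` is the
affine relation seen from `p i` and `p j`. -/
theorem bracketRel : BracketRel (vbr p ξ 0 2 3) (vbr p ξ 0 1 3) (-vbr p ξ 1 2 3) (-vbr p ξ 0 1 2)
    (vbr p ξ 0 3 4) (vbr p ξ 0 1 4) (-vbr p ξ 1 3 4) (vbr p ξ 1 2 4) (-vbr p ξ 2 3 4)
    (vol₀ p) (vol₁ p) (vol₂ p) (vol₃ p) (vol₄ p) := by
  have rot := bracket_rotate ξ
  have swap := bracket_swap ξ
  have deg : ∀ x y : E3, bracket ξ x y x = 0 ∧ bracket ξ x y y = 0 := by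
    intro x y; constructor <;> simp only [bracket, det3_eq, PiLp.sub_apply] <;> ring
  have vb := vol_bracket p ξ
  constructor
  · linear_combination bracket_quad ξ (p 0) (p 1) (p 2) (p 3)
  · linear_combination bracket_quad ξ (p 0) (p 1) (p 3) (p 4)
  · linear_combination bracket_quad ξ (p 1) (p 2) (p 3) (p 4)
  · have := bracket_plucker ξ (p 3) (p 0) (p 1) (p 2) (p 4)
    simp only [vbr]
    rw [← rot (p 0) (p 2) (p 3), ← rot (p 2) (p 3) (p 0), ← rot (p 0) (p 1) (p 3),
      ← rot (p 1) (p 3) (p 0), ← rot (p 1) (p 2) (p 3), ← rot (p 2) (p 3) (p 1),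
      ← rot (p 0) (p 3) (p 4), ← rot (p 1) (p 3) (p 4), ← rot (p 2) (p 3) (p 4)]
    rw [swap (p 3) (p 0) (p 4), swap (p 3) (p 1) (p 4), swap (p 3) (p 2) (p 4)]
    linear_combination -this
  · have := bracket_plucker ξ (p 1) (p 0) (p 2) (p 3) (p 4)
    simp only [vbr]
    rw [← rot (p 0) (p 1) (p 2), ← rot (p 0) (p 1) (p 3), ← rot (p 0) (p 1) (p 4),
      swap (p 1) (p 0) (p 2), swap (p 1) (p 0) (p 3), swap (p 1) (p 0) (p 4)]
    linear_combination this
  · have := vb (p 0) (p 1)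
    rw [(deg _ _).1, (deg _ _).2] at this
    linear_combination this
  · have := vb (p 2) (p 3)
    rw [(deg _ _).1, (deg _ _).2, rot (p 0), rot (p 1)] at this
    linear_combination this
  · have := vb (p 3) (p 4)
    rw [(deg _ _).1, (deg _ _).2, rot (p 0), rot (p 1), rot (p 2)] at this
    linear_combination this
  · have := vb (p 1) (p 4)
    rw [(deg _ _).1, (deg _ _).2, rot (p 0), swap (p 1) (p 2), swap (p 1) (p 3)] at this
    linear_combination this
  · have := vb (p 0) (p 3)
    rw [(deg _ _).1, (deg _ _).2, swap (p 0) (p 1), swap (p 0) (p 2)] at this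
    linear_combination this
  · have := vb (p 1) (p 2)
    rw [(deg _ _).1, (deg _ _).2, rot (p 0)] at this
    linear_combination this

variable {p ξ}

theorem crossAt_zero_two_iff (hp : IsSimpleChain (n := 4) p) (hξ : IsRegularDirection p ξ)
    {s t : ℝ} : CrossAt (n := 4) p ξ (0, s) (2, t) ↔
      0 < vbr p ξ 0 1 3 * -vbr p ξ 0 1 2 ∧ 0 < vbr p ξ 0 2 3 * -vbr p ξ 1 2 3 ∧
      s = vbr p ξ 0 2 3 / (vbr p ξ 0 2 3 + -vbr p ξ 1 2 3) ∧
      t = vbr p ξ 0 1 2 / (vbr p ξ 0 1 2 - vbr p ξ 0 1 3) := by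
  have := crossAt_iff hp hξ (show (0 : Fin 4) ≠ 2 by decide) (s := s) (t := t)
  rw [this]
  change vbr p ξ 0 1 2 * vbr p ξ 0 1 3 < 0 ∧ vbr p ξ 2 3 0 * vbr p ξ 2 3 1 < 0 ∧
    s = vbr p ξ 2 3 0 / (vbr p ξ 2 3 0 - vbr p ξ 2 3 1) ∧
    t = vbr p ξ 0 1 2 / (vbr p ξ 0 1 2 - vbr p ξ 0 1 3) ↔ _
  rw [show vbr p ξ 2 3 0 = vbr p ξ 0 2 3 from bracket_rotate _ _ _ _,
    show vbr p ξ 2 3 1 = vbr p ξ 1 2 3 from bracket_rotate _ _ _ _, sub_eq_add_neg,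
    mul_neg, mul_neg, neg_pos, neg_pos, mul_comm (vbr p ξ 0 1 3)]

theorem crossAt_zero_three_iff (hp : IsSimpleChain (n := 4) p) (hξ : IsRegularDirection p ξ)
    {s t : ℝ} : CrossAt (n := 4) p ξ (0, s) (3, t) ↔
      vbr p ξ 0 1 3 * vbr p ξ 0 1 4 < 0 ∧ 0 < vbr p ξ 0 3 4 * -vbr p ξ 1 3 4 ∧
      s = vbr p ξ 0 3 4 / (vbr p ξ 0 3 4 + -vbr p ξ 1 3 4) ∧
      t = vbr p ξ 0 1 3 / (vbr p ξ 0 1 3 - vbr p ξ 0 1 4) := by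
  have := crossAt_iff hp hξ (show (0 : Fin 4) ≠ 3 by decide) (s := s) (t := t)
  rw [this]
  change vbr p ξ 0 1 3 * vbr p ξ 0 1 4 < 0 ∧ vbr p ξ 3 4 0 * vbr p ξ 3 4 1 < 0 ∧
    s = vbr p ξ 3 4 0 / (vbr p ξ 3 4 0 - vbr p ξ 3 4 1) ∧
    t = vbr p ξ 0 1 3 / (vbr p ξ 0 1 3 - vbr p ξ 0 1 4) ↔ _
  rw [show vbr p ξ 3 4 0 = vbr p ξ 0 3 4 from bracket_rotate _ _ _ _,
    show vbr p ξ 3 4 1 = vbr p ξ 1 3 4 from bracket_rotate _ _ _ _, sub_eq_add_neg,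
    mul_neg, neg_pos]

theorem crossAt_one_three_iff (hp : IsSimpleChain (n := 4) p) (hξ : IsRegularDirection p ξ)
    {s t : ℝ} : CrossAt (n := 4) p ξ (1, s) (3, t) ↔
      0 < -vbr p ξ 1 2 3 * vbr p ξ 1 2 4 ∧ -vbr p ξ 1 3 4 * -vbr p ξ 2 3 4 < 0 ∧
      s = vbr p ξ 1 3 4 / (vbr p ξ 1 3 4 - vbr p ξ 2 3 4) ∧
      t = -vbr p ξ 1 2 3 / (-vbr p ξ 1 2 3 + vbr p ξ 1 2 4) := by
  have := crossAt_iff hp hξ (show (1 : Fin 4) ≠ 3 by decide) (s := s) (t := t)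
  rw [this]
  change vbr p ξ 1 2 3 * vbr p ξ 1 2 4 < 0 ∧ vbr p ξ 3 4 1 * vbr p ξ 3 4 2 < 0 ∧
    s = vbr p ξ 3 4 1 / (vbr p ξ 3 4 1 - vbr p ξ 3 4 2) ∧
    t = vbr p ξ 1 2 3 / (vbr p ξ 1 2 3 - vbr p ξ 1 2 4) ↔ _
  rw [show vbr p ξ 3 4 1 = vbr p ξ 1 3 4 from bracket_rotate _ _ _ _,
    show vbr p ξ 3 4 2 = vbr p ξ 2 3 4 from bracket_rotate _ _ _ _, neg_mul_neg, neg_mul, neg_pos,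
    ← sub_neg_eq_add, ← neg_sub', neg_div_neg_eq]

end Five

/-! ### Signs of crossings -/

section Signs

variable {p : Fin 5 → E3} {ξ : E3}

theorem det3_smul_right (u v w : E3) (c : ℝ) : det3 u v (c • w) = c * det3 u v w := by
  rw [det3, det3, inner_smul_right]

/-- The vertical chord at a crossing is the height difference times `ξ`, and it differs from `p i -
p j` by multiples of the two edge vectors, which the determinant ignores. Hence the sign of a
crossing does not depend on `ξ`. -/
theorem CrossAt.det3_mul_height (hξ : ‖ξ‖ = 1) {x y : Fin 4 × ℝ}
    (h : CrossAt (n := 4) p ξ x y) :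
    inner ℝ (cross (edgeVec (n := 4) p x.1) (edgeVec (n := 4) p y.1)) ξ *
      (inner ℝ (chainPoint (n := 4) p x) ξ - inner ℝ (chainPoint (n := 4) p y) ξ) =
    inner ℝ (cross (edgeVec (n := 4) p x.1) (edgeVec (n := 4) p y.1))
      (p x.1.castSucc - p y.1.castSucc) := by
  obtain ⟨k, hk⟩ := (proj_eq_proj_iff hξ _ _).1 h.2.2.2
  rw [inner_sub_inner_of_sub_eq hξ hk, mul_comm]
  have h1 := det3_smul_right (edgeVec (n := 4) p x.1) (edgeVec (n := 4) p y.1) ξ k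
  rw [← hk] at h1
  unfold det3 at h1
  rw [← h1]
  simp only [chainPoint, edgeVec, AffineMap.lineMap_apply_module']
  change det3 _ _ _ = det3 _ _ _
  simp only [det3_eq, PiLp.sub_apply, PiLp.add_apply, PiLp.smul_apply, smul_eq_mul]
  ring

theorem CrossAt.positiveAt_iff (hξ : ‖ξ‖ = 1) {x y : Fin 4 × ℝ}
    (h : CrossAt (n := 4) p ξ x y) : PositiveAt (n := 4) p ξ x y ↔
      0 < inner ℝ (cross (edgeVec (n := 4) p x.1) (edgeVec (n := 4) p y.1))
        (p x.1.castSucc - p y.1.castSucc) := by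
  rw [PositiveAt, h.det3_mul_height hξ]

theorem eps13_arg : (inner ℝ (cross (edgeVec (n := 4) p 0) (edgeVec (n := 4) p 2))
    (p (0 : Fin 4).castSucc - p (2 : Fin 4).castSucc) : ℝ) = vol₄ p := by
  change det3 (p 1 - p 0) (p 3 - p 2) (p 0 - p 2) = _
  simp only [vol₄, det3_eq, PiLp.sub_apply]; ring

theorem eps14_arg : (inner ℝ (cross (edgeVec (n := 4) p 0) (edgeVec (n := 4) p 3))
    (p (0 : Fin 4).castSucc - p (3 : Fin 4).castSucc) : ℝ) = vol₂ p := by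
  change det3 (p 1 - p 0) (p 4 - p 3) (p 0 - p 3) = _
  simp only [vol₂, det3_eq, PiLp.sub_apply]; ring

theorem eps13_eq : eps13 p = SignType.sign (vol₄ p) := by
  rw [eps13, crossingSign, eps13_arg]

theorem eps14_eq : eps14 p = SignType.sign (vol₂ p) := by
  rw [eps14, crossingSign, eps14_arg]

theorem cross_zero_two : inner ℝ (cross (edgeVec (n := 4) p 0) (edgeVec (n := 4) p 2)) ξ =
    vbr p ξ 0 1 3 + -vbr p ξ 0 1 2 := by
  change det3 (p 1 - p 0) (p 3 - p 2) ξ = _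
  simp only [vbr, bracket, det3_eq, PiLp.sub_apply]; ring

theorem cross_zero_three : inner ℝ (cross (edgeVec (n := 4) p 0) (edgeVec (n := 4) p 3)) ξ =
    vbr p ξ 0 1 4 - vbr p ξ 0 1 3 := by
  change det3 (p 1 - p 0) (p 4 - p 3) ξ = _
  simp only [vbr, bracket, det3_eq, PiLp.sub_apply]; ring

theorem cross_one_three : inner ℝ (cross (edgeVec (n := 4) p 1) (edgeVec (n := 4) p 3)) ξ =
    vbr p ξ 1 3 4 - vbr p ξ 2 3 4 := by
  change det3 (p 2 - p 1) (p 4 - p 3) ξ = _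
  simp only [vbr, bracket, det3_eq, PiLp.sub_apply]; ring

theorem CrossAt.height_sub_ne_zero (hp : IsSimpleChain (n := 4) p) {x y : Fin 4 × ℝ}
    (h : CrossAt (n := 4) p ξ x y) :
    (inner ℝ (chainPoint (n := 4) p x) ξ - inner ℝ (chainPoint (n := 4) p y) ξ : ℝ) ≠ 0 :=
  sub_ne_zero.2 (hp.height_ne h)

theorem CrossAt.vol₄_ne_zero (hp : IsSimpleChain (n := 4) p) (hξ : IsRegularDirection p ξ)
    {s t : ℝ} (h : CrossAt (n := 4) p ξ (0, s) (2, t)) : vol₄ p ≠ 0 := by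
  rw [← eps13_arg, ← h.det3_mul_height hξ.norm_eq]
  refine mul_ne_zero ?_ (h.height_sub_ne_zero hp)
  rw [cross_zero_two]
  have := ((crossAt_zero_two_iff hp hξ).1 h).1
  intro h0
  rw [eq_neg_of_add_eq_zero_right h0, mul_neg] at this
  exact absurd (mul_self_nonneg (vbr p ξ 0 1 3)) (by linarith)

theorem CrossAt.vol₂_ne_zero (hp : IsSimpleChain (n := 4) p) (hξ : IsRegularDirection p ξ)
    {s t : ℝ} (h : CrossAt (n := 4) p ξ (0, s) (3, t)) : vol₂ p ≠ 0 := by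
  rw [← eps14_arg, ← h.det3_mul_height hξ.norm_eq]
  refine mul_ne_zero ?_ (h.height_sub_ne_zero hp)
  rw [cross_zero_three]
  have := ((crossAt_zero_three_iff hp hξ).1 h).1
  intro h0
  rw [sub_eq_zero.1 h0] at this
  exact absurd (mul_self_nonneg (vbr p ξ 0 1 3)) (by linarith)

/-- The conditions on the five points under which there are diagrams of the first kind. -/
def IsPiercing (p : Fin 5 → E3) : Prop :=
  0 < vol₂ p * vol₄ p ∧ 0 < vol₂ p * vol₃ p ∧ 0 < vol₀ p * vol₁ p

/-- The directions, up to sign, with diagrams of the first kind. -/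
def InRegion (p : Fin 5 → E3) (ξ : E3) : Prop :=
  0 < vbr p ξ 0 2 3 ∧ vbr p ξ 0 1 4 < 0 ∧ vbr p ξ 1 2 4 < 0 ∧ 0 < -vbr p ξ 2 3 4

theorem inRegion_neg : InRegion p (-ξ) ↔
    vbr p ξ 0 2 3 < 0 ∧ 0 < vbr p ξ 0 1 4 ∧ 0 < vbr p ξ 1 2 4 ∧ -vbr p ξ 2 3 4 < 0 := by
  simp only [InRegion, vbr, bracket_neg, neg_pos, neg_neg, Left.neg_neg_iff]

theorem vol₀_eq_zero_of_cross (h : cross (p 2 - p 1) (p 4 - p 1) = 0) : vol₀ p = 0 := by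
  have : vol₀ p = -det3 (p 2 - p 1) (p 4 - p 1) (p 3 - p 1) := by
    simp only [vol₀, det3_eq, PiLp.sub_apply]; ring
  rw [this, det3, h, inner_zero_left, neg_zero]

theorem pos_iff_pos_iff_mul_pos {a b : ℝ} (ha : a ≠ 0) (hb : b ≠ 0) :
    (0 < a ↔ 0 < b) ↔ 0 < a * b := by
  constructor
  · intro h
    rcases lt_or_gt_of_ne ha with h' | h'
    · exact mul_pos_of_neg_of_neg h' (lt_of_le_of_ne (not_lt.1 fun hc => lt_asymm h' (h.2 hc)) hb)
    · exact mul_pos h' (h.1 h')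
  · intro h
    exact ⟨fun h' => pos_of_mul_pos_right h h'.le, fun h' => pos_of_mul_pos_left h h'.le⟩

/-- Equality of the two crossing signs is `0 < vol₂ * vol₄`. From there `coeff_sign` yields the
piercing, and `region_iff` turns the crossing conditions into the polygon or its antipode. -/
theorem isDiagramBi_iff (hp : IsSimpleChain (n := 4) p) (hξ : IsRegularDirection p ξ) :
    IsDiagramBi p ξ ↔ IsPiercing p ∧ (InRegion p ξ ∨ InRegion p (-ξ)) := by
  have hrel := bracketRel p ξ
  have hsum := vol_sum p
  constructor
  · rintro ⟨-, ⟨s, t, s', t', h13, h14, hlt, hpos⟩, hnot⟩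
    have c13 := (crossAt_zero_two_iff hp hξ).1 h13
    have c14 := (crossAt_zero_three_iff hp hξ).1 h14
    rw [h13.positiveAt_iff hξ.norm_eq, h14.positiveAt_iff hξ.norm_eq] at hpos
    simp only [eps13_arg, eps14_arg] at hpos
    rw [pos_iff_pos_iff_mul_pos (h13.vol₄_ne_zero hp hξ) (h14.vol₂_ne_zero hp hξ), mul_comm] at hpos
    rw [c13.2.2.1, c14.2.2.1, hrel.order_iff c13.1 c14.1] at hlt
    obtain ⟨h23, h01⟩ := hrel.coeff_sign c13.1 c13.2.1 c14.1 c14.2.1 hlt hpos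
    -- For a regular direction a zero bracket means that `p 1`, `p 2`, `p 4` are collinear, so that
    -- `vol₀` would vanish.
    have hv2 : vbr p ξ 1 2 4 ≠ 0 := fun h0 => by
      rw [vol₀_eq_zero_of_cross (hξ.cross_eq_zero _ _ _ h0)] at h01
      simp at h01
    refine ⟨⟨hpos, h23, h01⟩, ?_⟩
    rw [inRegion_neg]
    refine (hrel.region_iff hv2 hpos h23 h01 hsum).1 ⟨c13.1, c13.2.1, c14.1, c14.2.1, hlt, ?_⟩
    intro hc
    exact hnot ⟨_, _, (crossAt_one_three_iff hp hξ).2 ⟨hc.1, hc.2, rfl, rfl⟩⟩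
  · rintro ⟨⟨hpos, h23, h01⟩, hreg⟩
    have hv2 : vbr p ξ 1 2 4 ≠ 0 := fun h0 => by
      rw [vol₀_eq_zero_of_cross (hξ.cross_eq_zero _ _ _ h0)] at h01
      simp at h01
    rw [inRegion_neg] at hreg
    obtain ⟨a1, a2, a3, a4, a5, a6⟩ := (hrel.region_iff hv2 hpos h23 h01 hsum).2 hreg
    have h13 := (crossAt_zero_two_iff hp hξ).2 ⟨a1, a2, rfl, rfl⟩
    have h14 := (crossAt_zero_three_iff hp hξ).2 ⟨a3, a4, rfl, rfl⟩
    refine ⟨hξ.isGeneric hp, ⟨_, _, _, _, h13, h14, (hrel.order_iff a1 a3).2 a5, ?_⟩, ?_⟩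
    · rw [h13.positiveAt_iff hξ.norm_eq, h14.positiveAt_iff hξ.norm_eq]
      simp only [eps13_arg, eps14_arg]
      rw [pos_iff_pos_iff_mul_pos (h13.vol₄_ne_zero hp hξ) (h14.vol₂_ne_zero hp hξ), mul_comm]
      exact hpos
    · rintro ⟨s, t, h⟩
      have := (crossAt_one_three_iff hp hξ).1 h
      exact a6 ⟨this.1, this.2.1⟩

end Signs

/-! ### The reversed chain -/

section Reverse

variable {p : Fin 5 → E3} {ξ : E3}

/-- The parameter of a point on the reversed chain. -/
def revParam (x : Fin 4 × ℝ) : Fin 4 × ℝ := (x.1.rev, 1 - x.2)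

theorem revParam_revParam (x : Fin 4 × ℝ) : revParam (revParam x) = x := by
  simp [revParam]

theorem revParam_injective : Function.Injective revParam :=
  Function.LeftInverse.injective revParam_revParam

theorem reverseChain_castSucc (i : Fin 4) :
    reverseChain (n := 4) p i.castSucc = p i.rev.succ := by
  rw [reverseChain, Fin.rev_castSucc]

theorem reverseChain_succ (i : Fin 4) :
    reverseChain (n := 4) p i.succ = p i.rev.castSucc := by
  rw [reverseChain, Fin.rev_succ]

theorem chainPoint_reverse (x : Fin 4 × ℝ) :
    chainPoint (reverseChain (n := 4) p) x = chainPoint (n := 4) p (revParam x) := by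
  rw [chainPoint, chainPoint, reverseChain_castSucc, reverseChain_succ, revParam]
  simp only [AffineMap.lineMap_apply_one_sub]

theorem edgeVec_reverse (i : Fin 4) :
    edgeVec (reverseChain (n := 4) p) i = -edgeVec (n := 4) p i.rev := by
  rw [edgeVec, edgeVec, reverseChain_castSucc, reverseChain_succ, neg_sub]

theorem revParam_time (x : Fin 4 × ℝ) :
    ((revParam x).1 : ℝ) + (revParam x).2 = 4 - ((x.1 : ℝ) + x.2) := by
  have h : ((x.1.rev : ℕ) : ℝ) = 3 - (x.1 : ℕ) := by
    have h1 : (x.1.rev : ℕ) + (x.1 : ℕ) = 3 := by rw [Fin.val_rev]; omega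
    have : ((x.1.rev : ℕ) : ℝ) + (x.1 : ℕ) = 3 := by exact_mod_cast h1
    linarith
  simp only [revParam]
  rw [h]; ring

theorem revParam_mem_Ioo {x : Fin 4 × ℝ} :
    (revParam x).2 ∈ Set.Ioo (0 : ℝ) 1 ↔ x.2 ∈ Set.Ioo (0 : ℝ) 1 := by
  simp only [revParam, Set.mem_Ioo]
  constructor <;> rintro ⟨h1, h2⟩ <;> constructor <;> linarith

theorem revParam_mem_Icc {x : Fin 4 × ℝ} :
    (revParam x).2 ∈ Set.Icc (0 : ℝ) 1 ↔ x.2 ∈ Set.Icc (0 : ℝ) 1 := by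
  simp only [revParam, Set.mem_Icc]
  constructor <;> rintro ⟨h1, h2⟩ <;> constructor <;> linarith

theorem IsSimpleChain.reverse (hp : IsSimpleChain (n := 4) p) :
    IsSimpleChain (reverseChain (n := 4) p) := by
  intro x y hx hy h
  rw [chainPoint_reverse, chainPoint_reverse] at h
  have := hp _ _ (revParam_mem_Icc.2 hx) (revParam_mem_Icc.2 hy) h
  rw [revParam_time, revParam_time] at this
  linarith

theorem reverseChain_reverseChain : reverseChain (n := 4) (reverseChain (n := 4) p) = p := by
  funext k; simp [reverseChain]

theorem crossAt_reverse {x y : Fin 4 × ℝ} :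
    CrossAt (reverseChain (n := 4) p) ξ x y ↔ CrossAt (n := 4) p ξ (revParam x) (revParam y) := by
  simp only [CrossAt, chainPoint_reverse, revParam_mem_Ioo, ne_eq, revParam_injective.eq_iff]

theorem positiveAt_reverse {x y : Fin 4 × ℝ} :
    PositiveAt (reverseChain (n := 4) p) ξ x y ↔
      PositiveAt (n := 4) p ξ (revParam x) (revParam y) := by
  simp only [PositiveAt, chainPoint_reverse, edgeVec_reverse]
  have : ∀ a b : E3, cross (-a) (-b) = cross a b := by
    intro a b; simp [cross]
  rw [this]
  rfl

theorem IsGeneric.reverse (h : IsGeneric (n := 4) p ξ) :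
    IsGeneric (reverseChain (n := 4) p) ξ := by
  constructor
  · intro x y hx hy hxy
    rw [chainPoint_reverse, chainPoint_reverse] at hxy
    have hx' : (revParam x).2 = 0 ∨ (revParam x).2 = 1 := by
      simp only [revParam]
      rcases hx with h | h
      · right; linarith
      · left; linarith
    have := h.1 _ _ hx' (revParam_mem_Icc.2 hy) hxy
    rw [revParam_time, revParam_time] at this
    linarith
  · intro x y z hx hy hz hxy hyz
    rw [chainPoint_reverse, chainPoint_reverse] at hxy hyz
    have := h.2 _ _ _ (revParam_mem_Ioo.2 hx) (revParam_mem_Ioo.2 hy) (revParam_mem_Ioo.2 hz)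
      hxy hyz
    simpa only [revParam_injective.eq_iff] using this

theorem isGeneric_reverse : IsGeneric (reverseChain (n := 4) p) ξ ↔ IsGeneric (n := 4) p ξ :=
  ⟨fun h => by simpa only [reverseChain_reverseChain] using h.reverse, IsGeneric.reverse⟩

/-- Reversal exchanges `e₁` with `e₄` and `e₂` with `e₃` and inverts the order along each edge;
crossing signs persist because both edge vectors are negated. -/
theorem isDiagramBii_iff_reverse :
    IsDiagramBii p ξ ↔ IsDiagramBi (reverseChain (n := 4) p) ξ := by
  have e0 : ∀ s : ℝ, revParam (0, s) = (3, 1 - s) := fun s => rfl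
  have e1 : ∀ s : ℝ, revParam (1, s) = (2, 1 - s) := fun s => rfl
  have e2 : ∀ s : ℝ, revParam (2, s) = (1, 1 - s) := fun s => rfl
  have e3 : ∀ s : ℝ, revParam (3, s) = (0, 1 - s) := fun s => rfl
  simp only [IsDiagramBii, IsDiagramBi, isGeneric_reverse, crossAt_reverse, positiveAt_reverse,
    e0, e1, e2, e3]
  refine and_congr_right fun _ => and_congr ⟨?_, ?_⟩ (not_congr ⟨?_, ?_⟩)
  · rintro ⟨s, t, s', t', h1, h2, hlt, hpos⟩
    refine ⟨1 - t, 1 - s, 1 - t', 1 - s', ?_⟩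
    simp only [sub_sub_cancel]
    refine ⟨h1.symm, h2.symm, by linarith, ?_⟩
    rw [positiveAt_comm (x := (3, t)), positiveAt_comm (x := (3, t'))]
    exact hpos
  · rintro ⟨s, t, s', t', h1, h2, hlt, hpos⟩
    refine ⟨1 - t, 1 - s, 1 - t', 1 - s', h1.symm, h2.symm, by linarith, ?_⟩
    rw [positiveAt_comm (x := (3, 1 - s)), positiveAt_comm (x := (3, 1 - s'))] at hpos
    exact hpos
  · rintro ⟨s, t, h⟩
    exact ⟨1 - t, 1 - s, by simpa only [sub_sub_cancel] using h.symm⟩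
  · rintro ⟨s, t, h⟩
    exact ⟨1 - t, 1 - s, h.symm⟩

end Reverse

/-! ### Gauss codes of chains with four edges -/

namespace GaussCode

theorem oddWrithe_single (a : ℕ) (o o' s : Bool) :
    oddWrithe [(a, o, s), (a, o', s)] = 0 := by
  simp [oddWrithe, oddTerm, posSum]

/-- The passes are at positions 0, 3 and 1, 2, so both crossings are even. -/
theorem oddWrithe_nested {a b : ℕ} (hab : a ≠ b) (o₁ o₂ o₃ o₄ s s' : Bool) :
    oddWrithe [(a, o₁, s), (b, o₂, s'), (b, o₃, s'), (a, o₄, s)] = 0 := by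
  have h3 : (1 + 1 + 1 : ZMod 2) ≠ 0 := by decide
  have h4 : (1 + (1 + 1) : ZMod 2) ≠ 0 := by decide
  simp [oddWrithe, oddTerm, posSum, hab, hab.symm, h3, h4]

/-- The two passes of either crossing are two positions apart, so both crossings are odd. -/
theorem oddWrithe_alternating {a b : ℕ} (hab : a ≠ b) (o₁ o₂ o₃ o₄ s s' : Bool) :
    oddWrithe [(a, o₁, s), (b, o₂, s'), (a, o₃, s), (b, o₄, s')] =
      2 * (signInt s + signInt s') := by
  have h2 : (1 + 1 : ZMod 2) = 0 := by decide
  simp [oddWrithe, oddTerm, posSum, hab, hab.symm, h2]; ring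

/-- The two passes of each crossing are three positions apart, so all crossings are even. -/
theorem oddWrithe_triple {a b c : ℕ} (hab : a ≠ b) (hac : a ≠ c) (hbc : b ≠ c)
    (o₁ o₂ o₃ o₄ o₅ o₆ s s' s'' : Bool) :
    oddWrithe [(a, o₁, s), (b, o₂, s'), (c, o₃, s''), (a, o₄, s), (b, o₅, s'), (c, o₆, s'')] = 0 := by
  have h2 : (1 + 1 : ZMod 2) = 0 := by decide
  simp [oddWrithe, oddTerm, posSum, hab, hab.symm, hac, hac.symm, hbc, hbc.symm, h2]

theorem isK21_k21 (o s : Bool) : (k21 o s).IsK21 := ⟨o, s, Relation.EqvGen.refl _⟩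

theorem eq_of_signInt_add_ne_zero {s s' : Bool} (h : 2 * (signInt s + signInt s') ≠ 0) : s = s' := by
  revert h; revert s s'; decide

end GaussCode

/-- The order of the passes along the chain. -/
def PassLT (x y : Fin 4 × ℝ) : Prop := x.1 < y.1 ∨ x.1 = y.1 ∧ x.2 < y.2

instance : Std.Irrefl PassLT := ⟨fun x h => by
  rcases h with h | h
  · exact lt_irrefl _ h
  · exact lt_irrefl _ h.2⟩

theorem PassLT.asymm {x y : Fin 4 × ℝ} (h : PassLT x y) (h' : PassLT y x) : False := by
  rcases h with h | ⟨h, hl⟩ <;> rcases h' with h' | ⟨h', hl'⟩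
  · exact lt_asymm h h'
  · exact h.ne' h'
  · exact h'.ne' h
  · exact lt_asymm hl hl'

theorem list_eq_of_pairwise_passLT {L M : List (Fin 4 × ℝ)} (hL : L.Pairwise PassLT)
    (hM : M.Pairwise PassLT) (h : ∀ x, x ∈ L ↔ x ∈ M) : L = M :=
  ((List.perm_ext_iff_of_nodup hL.nodup hM.nodup).2 h).eq_of_pairwise
    (fun _ _ _ _ h h' => (h.asymm h').elim) hL hM

section Codes

variable {p : Fin 5 → E3} {ξ : E3}

open Classical in
/-- The entry of the Gauss code for one pass, with crossings named by `f`. -/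
noncomputable def gaussPass (p : Fin 5 → E3) (ξ : E3) (f : E3 → ℕ) (x : Fin 4 × ℝ) :
    ℕ × Bool × Bool :=
  (f (proj ξ (chainPoint (n := 4) p x)), decide (∃ y, CrossAt (n := 4) p ξ x y ∧ Above p ξ x y),
    decide (∃ y, CrossAt (n := 4) p ξ x y ∧ PositiveAt (n := 4) p ξ x y))

theorem CrossAt.unique (hg : IsGeneric (n := 4) p ξ) {x y z : Fin 4 × ℝ}
    (h : CrossAt (n := 4) p ξ x y) (h' : CrossAt (n := 4) p ξ x z) : y = z := by
  rcases hg.2 y x z h.2.2.1 h.2.1 h'.2.2.1 h.2.2.2.symm h'.2.2.2 with h1 | h1 | h1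
  · exact absurd h1.symm h.1
  · exact absurd h1 h'.1
  · exact h1

theorem CrossAt.exists_and_iff (hg : IsGeneric (n := 4) p ξ) {x y : Fin 4 × ℝ}
    (h : CrossAt (n := 4) p ξ x y) (q : Fin 4 × ℝ → Prop) :
    (∃ z, CrossAt (n := 4) p ξ x z ∧ q z) ↔ q y :=
  ⟨fun ⟨_, hz, hq⟩ => (h.unique hg hz) ▸ hq, fun hq => ⟨y, h, hq⟩⟩

open Classical in
theorem CrossAt.gaussPass_eq (hp : IsSimpleChain (n := 4) p) (hg : IsGeneric (n := 4) p ξ)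
    {x y : Fin 4 × ℝ} (h : CrossAt (n := 4) p ξ x y) (f : E3 → ℕ) :
    gaussPass p ξ f x = (f (proj ξ (chainPoint (n := 4) p x)), decide (Above (n := 4) p ξ x y),
      decide (PositiveAt (n := 4) p ξ x y)) ∧
    gaussPass p ξ f y = (f (proj ξ (chainPoint (n := 4) p x)), !decide (Above (n := 4) p ξ x y),
      decide (PositiveAt (n := 4) p ξ x y)) := by
  have habove : Above (n := 4) p ξ y x ↔ ¬Above (n := 4) p ξ x y := by
    unfold Above
    rw [not_lt]
    exact ⟨le_of_lt, fun hle => lt_of_le_of_ne hle (hp.height_ne h)⟩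
  constructor
  · simp only [gaussPass, h.exists_and_iff hg]
  · simp only [gaussPass, h.symm.exists_and_iff hg, h.2.2.2, habove, decide_not,
      positiveAt_comm (x := y) (y := x)]

/-- The order along the chain determines the list of passes, so only the names of the crossings are
free; distinct crossings keep distinct names. -/
theorem IsGaussCodeOf.exists_naming {c : GaussCode} (h : IsGaussCodeOf (n := 4) p ξ c)
    {M : List (Fin 4 × ℝ)} (hM : M.Pairwise PassLT)
    (hmem : ∀ x, x ∈ M ↔ ∃ y, CrossAt (n := 4) p ξ x y) :
    ∃ f : E3 → ℕ, c = M.map (gaussPass p ξ f) ∧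
      ∀ x ∈ M, ∀ y ∈ M, x ≠ y → ¬CrossAt (n := 4) p ξ x y →
        f (proj ξ (chainPoint (n := 4) p x)) ≠ f (proj ξ (chainPoint (n := 4) p y)) := by
  obtain ⟨L, f, hL, hLmem, hinj, rfl⟩ := h
  obtain rfl : L = M := list_eq_of_pairwise_passLT hL hM fun x => (hLmem x).trans (hmem x).symm
  refine ⟨f, rfl, fun x hx y hy hne hnc heq => hnc ?_⟩
  obtain ⟨x', hx'⟩ := (hmem x).1 hx
  obtain ⟨y', hy'⟩ := (hmem y).1 hy
  exact ⟨hne, hx'.2.1, hy'.2.1, hinj ⟨x, hx, rfl⟩ ⟨y, hy, rfl⟩ heq⟩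

theorem isGaussCodeOf_map {M : List (Fin 4 × ℝ)} (hM : M.Pairwise PassLT)
    (hmem : ∀ x, x ∈ M ↔ ∃ y, CrossAt (n := 4) p ξ x y) {f : E3 → ℕ}
    (hf : Set.InjOn f {q | ∃ x ∈ M, q = proj ξ (chainPoint (n := 4) p x)}) :
    IsGaussCodeOf (n := 4) p ξ (M.map (gaussPass p ξ f)) :=
  ⟨M, f, hM, hmem, hf, rfl⟩

theorem exists_crossAt_iff (hp : IsSimpleChain (n := 4) p) (hξ : IsRegularDirection p ξ)
    (x : Fin 4 × ℝ) : (∃ y, CrossAt (n := 4) p ξ x y) ↔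
      (∃ s t, CrossAt (n := 4) p ξ (0, s) (2, t) ∧ (x = (0, s) ∨ x = (2, t))) ∨
      (∃ s t, CrossAt (n := 4) p ξ (0, s) (3, t) ∧ (x = (0, s) ∨ x = (3, t))) ∨
      (∃ s t, CrossAt (n := 4) p ξ (1, s) (3, t) ∧ (x = (1, s) ∨ x = (3, t))) := by
  constructor
  · rintro ⟨⟨j, t⟩, h⟩
    obtain ⟨i, s⟩ := x
    have hna := h.nonadjacent hp hξ
    fin_cases i <;> fin_cases j <;> first
      | (simp at hna; done)
      | exact Or.inl ⟨_, _, h, Or.inl rfl⟩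
      | exact Or.inl ⟨_, _, h.symm, Or.inr rfl⟩
      | exact Or.inr (Or.inl ⟨_, _, h, Or.inl rfl⟩)
      | exact Or.inr (Or.inl ⟨_, _, h.symm, Or.inr rfl⟩)
      | exact Or.inr (Or.inr ⟨_, _, h, Or.inl rfl⟩)
      | exact Or.inr (Or.inr ⟨_, _, h.symm, Or.inr rfl⟩)
  · rintro (⟨s, t, h, rfl | rfl⟩ | ⟨s, t, h, rfl | rfl⟩ | ⟨s, t, h, rfl | rfl⟩)
    all_goals first | exact ⟨_, h⟩ | exact ⟨_, h.symm⟩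

theorem exists_crossAt_and_iff (hp : IsSimpleChain (n := 4) p) (hξ : IsRegularDirection p ξ)
    {i j : Fin 4} (hij : i ≠ j) {s t : ℝ} (h : CrossAt (n := 4) p ξ (i, s) (j, t))
    (x : Fin 4 × ℝ) :
    (∃ s t, CrossAt (n := 4) p ξ (i, s) (j, t) ∧ (x = (i, s) ∨ x = (j, t))) ↔
      x = (i, s) ∨ x = (j, t) := by
  constructor
  · rintro ⟨s', t', h', hx⟩
    have h1 := ((crossAt_iff hp hξ hij).1 h).2.2
    have h2 := ((crossAt_iff hp hξ hij).1 h').2.2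
    rwa [h1.1, h1.2, ← h2.1, ← h2.2]
  · intro hx; exact ⟨s, t, h, hx⟩

theorem exists_crossAt_and_iff_false {i j : Fin 4} (x : Fin 4 × ℝ)
    (h : ¬∃ s t, CrossAt (n := 4) p ξ (i, s) (j, t)) :
    (∃ s t, CrossAt (n := 4) p ξ (i, s) (j, t) ∧ (x = (i, s) ∨ x = (j, t))) ↔ False :=
  iff_false_intro fun ⟨s, t, h', _⟩ => h ⟨s, t, h'⟩

theorem mul_pos_iff_neg_of_neg {d h : ℝ} (hd : d < 0) : 0 < d * h ↔ h < 0 := by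
  rw [← neg_mul_neg, mul_pos_iff_of_pos_left (neg_pos.2 hd), neg_pos]

theorem neg_of_pos_mul_iff {d d' h h' : ℝ} (hd : d * d' < 0) (hh : h ≠ 0) (hh' : h' ≠ 0)
    (hpos : 0 < d * h ↔ 0 < d' * h') : 0 < h' ↔ ¬0 < h := by
  rcases mul_neg_iff.1 hd with ⟨h1, h2⟩ | ⟨h1, h2⟩
  · rw [mul_pos_iff_of_pos_left h1, mul_pos_iff_neg_of_neg h2] at hpos
    rw [hpos, not_lt, le_iff_lt_or_eq, or_iff_left hh'.symm]
  · rw [mul_pos_iff_neg_of_neg h1, mul_pos_iff_of_pos_left h2] at hpos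
    rw [← hpos, not_lt, le_iff_lt_or_eq, or_iff_left hh]

/-- The sign of a crossing is that of the turning direction times the height difference. Equal signs
with opposite turning directions require opposite heights. -/
theorem CrossAt.above_iff (hp : IsSimpleChain (n := 4) p) {x y x' y' : Fin 4 × ℝ}
    (h : CrossAt (n := 4) p ξ x y) (h' : CrossAt (n := 4) p ξ x' y')
    (hd : inner ℝ (cross (edgeVec (n := 4) p x.1) (edgeVec (n := 4) p y.1)) ξ *
      inner ℝ (cross (edgeVec (n := 4) p x'.1) (edgeVec (n := 4) p y'.1)) ξ < 0)
    (hpos : PositiveAt (n := 4) p ξ x y ↔ PositiveAt (n := 4) p ξ x' y') :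
    Above (n := 4) p ξ x' y' ↔ ¬Above (n := 4) p ξ x y := by
  have := neg_of_pos_mul_iff hd (h.height_sub_ne_zero hp) (h'.height_sub_ne_zero hp) hpos
  rw [sub_pos, sub_pos] at this
  exact this

end Codes

/-! ### Crossing patterns that represent k2.1 -/

section Codes

variable {p : Fin 5 → E3} {ξ : E3}

/-- Two crossings, passed in the order `x, x', y, y'`. -/
theorem projectsToK21_of_alternating (hp : IsSimpleChain (n := 4) p)
    (hg : IsGeneric (n := 4) p ξ) {x y x' y' : Fin 4 × ℝ} (h : CrossAt (n := 4) p ξ x y)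
    (h' : CrossAt (n := 4) p ξ x' y') (hM : [x, x', y, y'].Pairwise PassLT)
    (hmem : ∀ z, (∃ w, CrossAt (n := 4) p ξ z w) ↔ z ∈ [x, x', y, y'])
    (hd : inner ℝ (cross (edgeVec (n := 4) p x.1) (edgeVec (n := 4) p y.1)) ξ *
      inner ℝ (cross (edgeVec (n := 4) p x'.1) (edgeVec (n := 4) p y'.1)) ξ < 0)
    (hpos : PositiveAt (n := 4) p ξ x y ↔ PositiveAt (n := 4) p ξ x' y') :
    ProjectsToK21 (n := 4) p ξ := by
  classical
  have hne : proj ξ (chainPoint (n := 4) p x) ≠ proj ξ (chainPoint (n := 4) p x') := by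
    intro heq
    have hxy : x ≠ x' := by
      rintro rfl
      exact (List.rel_of_pairwise_cons hM (List.mem_cons_self)).asymm
        (List.rel_of_pairwise_cons hM (List.mem_cons_self))
    have h1 : CrossAt (n := 4) p ξ x x' := ⟨hxy, h.2.1, h'.2.1, heq⟩
    have h2 := h.unique hg h1
    subst h2
    have hlt : PassLT y y := List.rel_of_pairwise_cons hM.of_cons (by simp)
    exact hlt.asymm hlt
  -- Naming the first crossing 0 and the second 1 makes the code literally a `k21`, so no
  -- Reidemeister move is needed.
  set f : E3 → ℕ := fun q => if q = proj ξ (chainPoint (n := 4) p x) then 0 else 1 with hf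
  have f0 : f (proj ξ (chainPoint (n := 4) p x)) = 0 := by simp [hf]
  have f1 : f (proj ξ (chainPoint (n := 4) p x')) = 1 := by simp [hf, hne.symm]
  have hinj : Set.InjOn f {q | ∃ z ∈ [x, x', y, y'], q = proj ξ (chainPoint (n := 4) p z)} := by
    have hcases : ∀ q ∈ {q | ∃ z ∈ [x, x', y, y'], q = proj ξ (chainPoint (n := 4) p z)},
        q = proj ξ (chainPoint (n := 4) p x) ∨ q = proj ξ (chainPoint (n := 4) p x') := by
      rintro q ⟨z, hz, rfl⟩
      simp only [List.mem_cons, List.not_mem_nil, or_false] at hz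
      rcases hz with rfl | rfl | rfl | rfl
      · exact Or.inl rfl
      · exact Or.inr rfl
      · exact Or.inl h.2.2.2.symm
      · exact Or.inr h'.2.2.2.symm
    intro a ha b hb hab
    rcases hcases a ha with rfl | rfl <;> rcases hcases b hb with rfl | rfl
    · rfl
    · rw [f0, f1] at hab; simp at hab
    · rw [f0, f1] at hab; simp at hab
    · rfl
  refine ⟨hg, _, isGaussCodeOf_map hM (fun z => (hmem z).symm) hinj, ?_⟩
  obtain ⟨g1, g2⟩ := h.gaussPass_eq hp hg f
  obtain ⟨g3, g4⟩ := h'.gaussPass_eq hp hg f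
  have hab := h.above_iff hp h' hd hpos
  simp only [List.map_cons, List.map_nil, g1, g2, g3, g4, f0, f1, hab, ← hpos, decide_not,
    Bool.not_not]
  exact GaussCode.isK21_k21 _ _

/-- Two crossings of opposite signs, passed alternately, are not a diagram of `k2.1`. -/
theorem ProjectsToK21.positiveAt_iff (hp : IsSimpleChain (n := 4) p)
    {x y x' y' : Fin 4 × ℝ} (hK : ProjectsToK21 (n := 4) p ξ) (h : CrossAt (n := 4) p ξ x y)
    (h' : CrossAt (n := 4) p ξ x' y') (hM : [x, x', y, y'].Pairwise PassLT)
    (hmem : ∀ z, (∃ w, CrossAt (n := 4) p ξ z w) ↔ z ∈ [x, x', y, y']) :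
    PositiveAt (n := 4) p ξ x y ↔ PositiveAt (n := 4) p ξ x' y' := by
  classical
  obtain ⟨hg, c, hc, hk⟩ := hK
  obtain ⟨f, rfl, hf⟩ := hc.exists_naming hM fun z => (hmem z).symm
  have hJ := hk.oddWrithe_ne_zero
  have h01 : PassLT x x' := List.rel_of_pairwise_cons hM (by simp)
  have h12 : PassLT x' y := List.rel_of_pairwise_cons hM.of_cons (by simp)
  have hne := hf x (by simp) x' (by simp) (by rintro rfl; exact h01.asymm h01) (by
    intro hx
    have := h.unique hg hx
    subst this
    exact h12.asymm h12)
  obtain ⟨g1, g2⟩ := h.gaussPass_eq hp hg f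
  obtain ⟨g3, g4⟩ := h'.gaussPass_eq hp hg f
  simp only [List.map_cons, List.map_nil, g1, g2, g3, g4] at hJ
  rw [GaussCode.oddWrithe_alternating hne] at hJ
  exact decide_eq_decide.1 (GaussCode.eq_of_signInt_add_ne_zero hJ)

theorem ProjectsToK21.not_nested (hp : IsSimpleChain (n := 4) p)
    {x y x' y' : Fin 4 × ℝ} (hK : ProjectsToK21 (n := 4) p ξ) (h : CrossAt (n := 4) p ξ x y)
    (h' : CrossAt (n := 4) p ξ x' y') (hM : [x, x', y', y].Pairwise PassLT)
    (hmem : ∀ z, (∃ w, CrossAt (n := 4) p ξ z w) ↔ z ∈ [x, x', y', y]) : False := by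
  classical
  obtain ⟨hg, c, hc, hk⟩ := hK
  obtain ⟨f, rfl, hf⟩ := hc.exists_naming hM fun z => (hmem z).symm
  have hJ := hk.oddWrithe_ne_zero
  have h01 : PassLT x x' := List.rel_of_pairwise_cons hM (by simp)
  have h13 : PassLT x' y := List.rel_of_pairwise_cons hM.of_cons (by simp)
  have hne := hf x (by simp) x' (by simp) (by rintro rfl; exact h01.asymm h01) (by
    intro hx
    have := h.unique hg hx
    subst this
    exact h13.asymm h13)
  obtain ⟨g1, g2⟩ := h.gaussPass_eq hp hg f
  obtain ⟨g3, g4⟩ := h'.gaussPass_eq hp hg f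
  simp only [List.map_cons, List.map_nil, g1, g2, g3, g4] at hJ
  exact hJ (GaussCode.oddWrithe_nested hne _ _ _ _ _ _)

theorem ProjectsToK21.not_single (hp : IsSimpleChain (n := 4) p)
    {x y : Fin 4 × ℝ} (hK : ProjectsToK21 (n := 4) p ξ) (h : CrossAt (n := 4) p ξ x y)
    (hM : [x, y].Pairwise PassLT)
    (hmem : ∀ z, (∃ w, CrossAt (n := 4) p ξ z w) ↔ z ∈ [x, y]) : False := by
  classical
  obtain ⟨hg, c, hc, hk⟩ := hK
  obtain ⟨f, rfl, hf⟩ := hc.exists_naming hM fun z => (hmem z).symm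
  have hJ := hk.oddWrithe_ne_zero
  obtain ⟨g1, g2⟩ := h.gaussPass_eq hp hg f
  simp only [List.map_cons, List.map_nil, g1, g2] at hJ
  exact hJ (GaussCode.oddWrithe_single _ _ _ _)

theorem ProjectsToK21.exists_crossAt (hK : ProjectsToK21 (n := 4) p ξ) :
    ∃ x y, CrossAt (n := 4) p ξ x y := by
  by_contra! hno
  obtain ⟨hg, c, hc, hk⟩ := hK
  obtain ⟨f, rfl, hf⟩ := hc.exists_naming (M := []) List.Pairwise.nil fun z => by
    simpa using hno z
  exact hk.oddWrithe_ne_zero rfl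

theorem ProjectsToK21.not_triple (hp : IsSimpleChain (n := 4) p)
    {x y x' y' x'' y'' : Fin 4 × ℝ} (hK : ProjectsToK21 (n := 4) p ξ)
    (h : CrossAt (n := 4) p ξ x y) (h' : CrossAt (n := 4) p ξ x' y')
    (h'' : CrossAt (n := 4) p ξ x'' y'') (hM : [x, x', x'', y, y', y''].Pairwise PassLT)
    (hmem : ∀ z, (∃ w, CrossAt (n := 4) p ξ z w) ↔ z ∈ [x, x', x'', y, y', y'']) : False := by
  classical
  obtain ⟨hg, c, hc, hk⟩ := hK
  obtain ⟨f, rfl, hf⟩ := hc.exists_naming hM fun z => (hmem z).symm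
  have hJ := hk.oddWrithe_ne_zero
  have irr : ∀ {z w : Fin 4 × ℝ}, PassLT z w → z ≠ w := fun hl he => by
    subst he; exact hl.asymm hl
  have hx' : x ≠ x' := irr (List.rel_of_pairwise_cons hM (by simp))
  have hx'' : x ≠ x'' := irr (List.rel_of_pairwise_cons hM (by simp))
  have hx'x'' : x' ≠ x'' := irr (List.rel_of_pairwise_cons hM.of_cons (by simp))
  have hx'y : x' ≠ y := irr (List.rel_of_pairwise_cons hM.of_cons (by simp))
  have hx''y : x'' ≠ y := irr (List.rel_of_pairwise_cons hM.of_cons.of_cons (by simp))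
  have hx''y' : x'' ≠ y' := irr (List.rel_of_pairwise_cons hM.of_cons.of_cons (by simp))
  have n1 := hf x (by simp) x' (by simp) hx' fun hc => hx'y (h.unique hg hc).symm
  have n2 := hf x (by simp) x'' (by simp) hx'' fun hc => hx''y (h.unique hg hc).symm
  have n3 := hf x' (by simp) x'' (by simp) hx'x'' fun hc => hx''y' (h'.unique hg hc).symm
  obtain ⟨g1, g2⟩ := h.gaussPass_eq hp hg f
  obtain ⟨g3, g4⟩ := h'.gaussPass_eq hp hg f
  obtain ⟨g5, g6⟩ := h''.gaussPass_eq hp hg f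
  simp only [List.map_cons, List.map_nil, g1, g2, g3, g4, g5, g6] at hJ
  exact hJ (GaussCode.oddWrithe_triple n1 n2 n3 _ _ _ _ _ _ _ _ _)

/-- The consecutive edges `e₃` and `e₄` both cross `e₁`: the second returns across the line that the
first has crossed. -/
theorem cross_mul_neg₁ (hp : IsSimpleChain (n := 4) p) (hξ : IsRegularDirection p ξ)
    {s t s' t' : ℝ} (h13 : CrossAt (n := 4) p ξ (0, s) (2, t))
    (h14 : CrossAt (n := 4) p ξ (0, s') (3, t')) :
    inner ℝ (cross (edgeVec (n := 4) p 0) (edgeVec (n := 4) p 2)) ξ *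
      inner ℝ (cross (edgeVec (n := 4) p 0) (edgeVec (n := 4) p 3)) ξ < 0 := by
  rw [cross_zero_two, cross_zero_three]
  have h1 := ((crossAt_zero_two_iff hp hξ).1 h13).1
  have h2 := ((crossAt_zero_three_iff hp hξ).1 h14).1
  generalize vbr p ξ 0 1 3 = a at *
  generalize -vbr p ξ 0 1 2 = b at *
  generalize vbr p ξ 0 1 4 = c at *
  rcases pos_and_pos_or_neg_and_neg_of_mul_pos h1 with ⟨ha, hb⟩ | ⟨ha, hb⟩
  · have : c < 0 := by nlinarith
    exact mul_neg_of_pos_of_neg (by linarith) (by linarith)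
  · have : 0 < c := by nlinarith
    exact mul_neg_of_neg_of_pos (by linarith) (by linarith)

/-- Here the consecutive edges `e₁` and `e₂` cross `e₄`, again in opposite directions. -/
theorem cross_mul_neg₂ (hp : IsSimpleChain (n := 4) p) (hξ : IsRegularDirection p ξ)
    {s t s' t' : ℝ} (h14 : CrossAt (n := 4) p ξ (0, s) (3, t))
    (h24 : CrossAt (n := 4) p ξ (1, s') (3, t')) :
    inner ℝ (cross (edgeVec (n := 4) p 0) (edgeVec (n := 4) p 3)) ξ *
      inner ℝ (cross (edgeVec (n := 4) p 1) (edgeVec (n := 4) p 3)) ξ < 0 := by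
  rw [cross_zero_three, cross_one_three, ← (bracketRel p ξ).u_sum]
  have h1 := ((crossAt_zero_three_iff hp hξ).1 h14).2.1
  have h2 := ((crossAt_one_three_iff hp hξ).1 h24).2.1
  generalize vbr p ξ 0 3 4 = a at *
  generalize vbr p ξ 1 3 4 = b at *
  generalize vbr p ξ 2 3 4 = c at *
  rcases pos_and_pos_or_neg_and_neg_of_mul_pos h1 with ⟨ha, hb⟩ | ⟨ha, hb⟩
  · have : 0 < c := by nlinarith
    exact mul_neg_of_pos_of_neg (by linarith) (by linarith)
  · have : c < 0 := by nlinarith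
    exact mul_neg_of_neg_of_pos (by linarith) (by linarith)

theorem projectsToK21_iff (hp : IsSimpleChain (n := 4) p) (hξ : IsRegularDirection p ξ) :
    ProjectsToK21 (n := 4) p ξ ↔ IsDiagramBi p ξ ∨ IsDiagramBii p ξ := by
  have hg := hξ.isGeneric hp
  have hex := exists_crossAt_iff hp hξ
  by_cases h13 : ∃ s t, CrossAt (n := 4) p ξ (0, s) (2, t) <;>
    by_cases h14 : ∃ s t, CrossAt (n := 4) p ξ (0, s) (3, t) <;>
    by_cases h24 : ∃ s t, CrossAt (n := 4) p ξ (1, s) (3, t)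
  · obtain ⟨s, t, h13⟩ := h13
    obtain ⟨s', t', h14⟩ := h14
    obtain ⟨s'', t'', h24⟩ := h24
    -- The bracket relations fix the order of the six passes as `a b c a b c`, for which the odd
    -- writhe is zero.
    refine iff_of_false (fun hK => ?_) ?_
    · have c13 := (crossAt_zero_two_iff hp hξ).1 h13
      have c14 := (crossAt_zero_three_iff hp hξ).1 h14
      have c24 := (crossAt_one_three_iff hp hξ).1 h24
      obtain ⟨-, -, e1, e2⟩ := (bracketRel p ξ).cross_of_cross c13.1 c13.2.1 c24.1 c24.2.1
      rw [← (bracketRel p ξ).order_iff c13.1 c14.1, ← c13.2.2.1, ← c14.2.2.1] at e1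
      rw [← c14.2.2.2, ← c24.2.2.2] at e2
      refine hK.not_triple hp h13 h14 h24 ?_ ?_
      · simp [PassLT, e1, e2]
      · intro z
        rw [hex, exists_crossAt_and_iff hp hξ (by decide) h13,
          exists_crossAt_and_iff hp hξ (by decide) h14,
          exists_crossAt_and_iff hp hξ (by decide) h24]
        simp only [List.mem_cons, List.not_mem_nil, or_false]
        tauto
    · rintro (h | h)
      · exact h.2.2 ⟨_, _, h24⟩
      · exact h.2.2 ⟨_, _, h13⟩
  · have hmem := hex
    simp only [exists_crossAt_and_iff_false _ h24] at hmem
    obtain ⟨s, t, h13⟩ := h13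
    obtain ⟨s', t', h14⟩ := h14
    simp only [exists_crossAt_and_iff hp hξ (show (0 : Fin 4) ≠ 2 by decide) h13,
      exists_crossAt_and_iff hp hξ (show (0 : Fin 4) ≠ 3 by decide) h14] at hmem
    have hne : s ≠ s' := by
      rintro rfl
      have h23 : (2 : Fin 4) = 3 := congrArg Prod.fst (h13.unique hg h14)
      exact absurd h23 (by decide)
    constructor
    · intro hK
      rcases lt_or_gt_of_ne hne with hlt | hlt
      · refine Or.inl ⟨hg, ⟨s, t, s', t', h13, h14, hlt, ?_⟩, h24⟩
        refine hK.positiveAt_iff hp h13 h14 ?_ ?_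
        · simp [PassLT, hlt]
        · intro z
          rw [hmem]
          simp only [List.mem_cons, List.not_mem_nil, or_false]
          tauto
      -- If `e₁` meets `e₄` before `e₃`, the crossings are nested.
      · exfalso
        refine hK.not_nested hp h14 h13 ?_ ?_
        · simp [PassLT, hlt]
        · intro z
          rw [hmem]
          simp only [List.mem_cons, List.not_mem_nil, or_false]
          tauto
    · rintro (⟨-, ⟨a, b, a', b', k13, k14, hlt, hpos⟩, -⟩ | h)
      · refine projectsToK21_of_alternating hp hg k13 k14 ?_ ?_
          (cross_mul_neg₁ hp hξ k13 k14) hpos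
        · simp [PassLT, hlt]
        · intro z
          rw [hex, exists_crossAt_and_iff hp hξ (by decide) k13,
            exists_crossAt_and_iff hp hξ (by decide) k14, exists_crossAt_and_iff_false _ h24]
          simp only [List.mem_cons, List.not_mem_nil, or_false]
          tauto
      · exact absurd ⟨_, _, h13⟩ h.2.2
  · exfalso
    obtain ⟨s, t, h13⟩ := h13
    obtain ⟨s'', t'', h24⟩ := h24
    have c13 := (crossAt_zero_two_iff hp hξ).1 h13
    have c24 := (crossAt_one_three_iff hp hξ).1 h24
    obtain ⟨e1, e2, -⟩ := (bracketRel p ξ).cross_of_cross c13.1 c13.2.1 c24.1 c24.2.1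
    exact h14 ⟨_, _, (crossAt_zero_three_iff hp hξ).2 ⟨e1, e2, rfl, rfl⟩⟩
  · refine iff_of_false (fun hK => ?_) ?_
    · have hmem := hex
      simp only [exists_crossAt_and_iff_false _ h24, exists_crossAt_and_iff_false _ h14] at hmem
      obtain ⟨s, t, h13⟩ := h13
      refine hK.not_single hp h13 (by simp [PassLT]) fun z => ?_
      rw [hmem, exists_crossAt_and_iff hp hξ (by decide) h13]
      simp
    · rintro (⟨-, ⟨_, _, _, _, _, h, -⟩, -⟩ | ⟨-, ⟨_, _, _, _, _, h, -⟩, -⟩) <;>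
        exact h14 ⟨_, _, h⟩
  · have hmem := hex
    simp only [exists_crossAt_and_iff_false _ h13] at hmem
    obtain ⟨s, t, h14⟩ := h14
    obtain ⟨s', t', h24⟩ := h24
    simp only [exists_crossAt_and_iff hp hξ (show (1 : Fin 4) ≠ 3 by decide) h24,
      exists_crossAt_and_iff hp hξ (show (0 : Fin 4) ≠ 3 by decide) h14] at hmem
    have hne : t ≠ t' := by
      rintro rfl
      have h01 : (0 : Fin 4) = 1 := congrArg Prod.fst (h14.symm.unique hg h24.symm)
      exact absurd h01 (by decide)
    constructor
    · intro hK
      rcases lt_or_gt_of_ne hne with hlt | hlt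
      · refine Or.inr ⟨hg, ⟨s', t', s, t, h24, h14, hlt, ?_⟩, h13⟩
        refine (hK.positiveAt_iff hp h14 h24 ?_ ?_).symm
        · simp [PassLT, hlt]
        · intro z
          rw [hmem]
          simp only [List.mem_cons, List.not_mem_nil, or_false]
          tauto
      · exfalso
        refine hK.not_nested hp h14 h24 ?_ ?_
        · simp [PassLT, hlt]
        · intro z
          rw [hmem]
          simp only [List.mem_cons, List.not_mem_nil, or_false]
          tauto
    · rintro (h | ⟨-, ⟨a, b, a', b', k24, k14, hlt, hpos⟩, -⟩)
      · exact absurd ⟨_, _, h24⟩ h.2.2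
      · refine projectsToK21_of_alternating hp hg k14 k24 ?_ ?_
          (cross_mul_neg₂ hp hξ k14 k24) hpos.symm
        · simp [PassLT, hlt]
        · intro z
          rw [hex, exists_crossAt_and_iff hp hξ (by decide) k24,
            exists_crossAt_and_iff hp hξ (by decide) k14, exists_crossAt_and_iff_false _ h13]
          simp only [List.mem_cons, List.not_mem_nil, or_false]
          tauto
  · refine iff_of_false (fun hK => ?_) ?_
    · have hmem := hex
      simp only [exists_crossAt_and_iff_false _ h24, exists_crossAt_and_iff_false _ h13] at hmem
      obtain ⟨s, t, h14⟩ := h14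
      refine hK.not_single hp h14 (by simp [PassLT]) fun z => ?_
      rw [hmem, exists_crossAt_and_iff hp hξ (by decide) h14]
      simp
    · rintro (⟨-, ⟨_, _, _, _, h, -⟩, -⟩ | ⟨-, ⟨_, _, _, _, h, -⟩, -⟩)
      · exact h13 ⟨_, _, h⟩
      · exact h24 ⟨_, _, h⟩
  · refine iff_of_false (fun hK => ?_) ?_
    · have hmem := hex
      simp only [exists_crossAt_and_iff_false _ h13, exists_crossAt_and_iff_false _ h14] at hmem
      obtain ⟨s, t, h24⟩ := h24
      refine hK.not_single hp h24 (by simp [PassLT]) fun z => ?_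
      rw [hmem, exists_crossAt_and_iff hp hξ (by decide) h24]
      simp
    · rintro (⟨-, ⟨_, _, _, _, _, h, -⟩, -⟩ | ⟨-, ⟨_, _, _, _, _, h, -⟩, -⟩) <;>
        exact h14 ⟨_, _, h⟩
  · refine iff_of_false (fun hK => ?_) ?_
    · obtain ⟨x, hx⟩ := hK.exists_crossAt
      rcases (hex x).1 hx with ⟨_, _, h, -⟩ | ⟨_, _, h, -⟩ | ⟨_, _, h, -⟩
      · exact h13 ⟨_, _, h⟩
      · exact h14 ⟨_, _, h⟩
      · exact h24 ⟨_, _, h⟩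
    · rintro (⟨-, ⟨_, _, _, _, _, h, -⟩, -⟩ | ⟨-, ⟨_, _, _, _, _, h, -⟩, -⟩) <;>
        exact h14 ⟨_, _, h⟩

end Codes

/-! ### Measure on the sphere of directions -/

section Sphere

open MeasureTheory Module
open scoped Pointwise

instance : IsFiniteMeasure sphereMeasure := by unfold sphereMeasure; infer_instance

/-- The area is defined by the volume of the cone over a set, and this cone lies in a proper
subspace. -/
theorem sphereMeasure_submodule {S : Submodule ℝ E3} (hS : S ≠ ⊤) :
    sphereMeasure {ξ | (ξ : E3) ∈ S} = 0 := by
  have hclosed : IsClosed (S : Set E3) := S.closed_of_finiteDimensional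
  have hmeas : MeasurableSet {ξ : Metric.sphere (0 : E3) 1 | (ξ : E3) ∈ S} :=
    (hclosed.preimage continuous_subtype_val).measurableSet
  rw [sphereMeasure, Measure.toSphere_apply' _ hmeas]
  have hsub : Set.Ioo (0 : ℝ) 1 • ((↑) '' {ξ : Metric.sphere (0 : E3) 1 | (ξ : E3) ∈ S}) ⊆
      (S : Set E3) := by
    rintro _ ⟨r, -, _, ⟨ξ, hξ, rfl⟩, rfl⟩
    exact S.smul_mem r hξ
  rw [measure_mono_null hsub (Measure.addHaar_submodule volume S hS), mul_zero]

theorem ae_inner_ne_zero {n : E3} (hn : n ≠ 0) :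
    ∀ᵐ ξ : Metric.sphere (0 : E3) 1 ∂sphereMeasure, (inner ℝ n (ξ : E3) : ℝ) ≠ 0 := by
  rw [ae_iff]
  simp only [not_not]
  refine sphereMeasure_submodule (S := LinearMap.ker (innerₛₗ ℝ n)) fun h => hn ?_
  have : n ∈ LinearMap.ker (innerₛₗ ℝ n) := h ▸ Submodule.mem_top
  exact inner_self_eq_zero.1 (LinearMap.mem_ker.1 this)

theorem ae_cross_ne_zero {u : E3} (hu : u ≠ 0) :
    ∀ᵐ ξ : Metric.sphere (0 : E3) 1 ∂sphereMeasure, cross u (ξ : E3) ≠ 0 := by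
  rw [ae_iff]
  simp only [not_not]
  have hne : Submodule.span ℝ {u} ≠ ⊤ := by
    intro h
    have h1 := finrank_span_singleton (K := ℝ) hu
    rw [h, finrank_top, finrank_euclideanSpace_fin] at h1
    norm_num at h1
  refine measure_mono_null (fun ξ hξ => ?_) (sphereMeasure_submodule hne)
  obtain ⟨c, hc⟩ := exists_smul_of_cross_eq_zero hu hξ
  exact Submodule.mem_span_singleton.2 ⟨c, hc.symm⟩

/-- The excluded directions lie in finitely many great circles, from planes through three
noncollinear points, and finitely many antipodal pairs, from lines through two distinct points. -/
theorem ae_isRegularDirection (p : Fin 5 → E3) :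
    ∀ᵐ ξ : Metric.sphere (0 : E3) 1 ∂sphereMeasure, IsRegularDirection p ξ := by
  have h1 : ∀ᵐ ξ : Metric.sphere (0 : E3) 1 ∂sphereMeasure, ∀ i j k,
      bracket ξ (p i) (p j) (p k) = 0 → cross (p j - p i) (p k - p i) = 0 := by
    simp only [ae_all_iff]
    intro i j k
    by_cases h : cross (p j - p i) (p k - p i) = 0
    · exact Filter.Eventually.of_forall fun _ _ => h
    · filter_upwards [ae_inner_ne_zero h] with ξ hξ h0
      exact absurd h0 hξ
  have h2 : ∀ᵐ ξ : Metric.sphere (0 : E3) 1 ∂sphereMeasure, ∀ i j,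
      cross (p j - p i) (ξ : E3) = 0 → p i = p j := by
    simp only [ae_all_iff]
    intro i j
    by_cases h : p j - p i = 0
    · exact Filter.Eventually.of_forall fun _ _ => (sub_eq_zero.1 h).symm
    · filter_upwards [ae_cross_ne_zero h] with ξ hξ h0
      exact absurd h0 hξ
  filter_upwards [h1, h2] with ξ h1 h2
  exact ⟨norm_eq_of_mem_sphere ξ, h1, h2⟩

theorem sphereMeasure_neg {s : Set (Metric.sphere (0 : E3) 1)} (hs : MeasurableSet s) :
    sphereMeasure {ξ | -ξ ∈ s} = sphereMeasure s := by
  have hs' : MeasurableSet {ξ : Metric.sphere (0 : E3) 1 | -ξ ∈ s} :=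
    continuous_neg.measurable hs
  rw [sphereMeasure, Measure.toSphere_apply' _ hs, Measure.toSphere_apply' _ hs',
    ← Measure.measure_neg]
  congr 2
  ext x
  simp only [Set.mem_neg, Set.mem_smul, Set.mem_image]
  constructor
  · rintro ⟨r, hr, _, ⟨ξ, hξ, rfl⟩, h⟩
    exact ⟨r, hr, _, ⟨-ξ, hξ, rfl⟩, by rw [coe_neg_sphere, smul_neg, h, neg_neg]⟩
  · rintro ⟨r, hr, _, ⟨ξ, hξ, rfl⟩, h⟩
    refine ⟨r, hr, _, ⟨-ξ, by simpa using hξ, rfl⟩, ?_⟩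
    rw [← h]; simp

theorem sphereMeasure_real_univ : sphereMeasure.real Set.univ = 4 * Real.pi := by
  rw [measureReal_def, sphereMeasure, Measure.toSphere_apply_univ, finrank_euclideanSpace_fin,
    EuclideanSpace.volume_ball_fin_three]
  rw [ENNReal.toReal_mul, ENNReal.toReal_mul]
  simp only [Nat.cast_ofNat, ENNReal.ofReal_one, one_pow, ENNReal.toReal_one, one_mul, ENNReal.toReal_ofNat]
  rw [ENNReal.toReal_ofReal (by positivity)]
  ring

end Sphere

/-! ### The quantities in the formula -/

section Formula

theorem inner_unitNormal (a b ξ : E3) :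
    inner ℝ (unitNormal a b) ξ = ‖cross a b‖⁻¹ * inner ℝ (cross a b) ξ := by
  rw [unitNormal, inner_smul_left]; rfl

theorem inner_unitNormal_pos_iff (a b ξ : E3) :
    0 < (inner ℝ (unitNormal a b) ξ : ℝ) ↔ 0 < (inner ℝ (cross a b) ξ : ℝ) := by
  rw [inner_unitNormal]
  rcases eq_or_ne (cross a b) 0 with h | h
  · simp [h]
  · exact mul_pos_iff_of_pos_left (inv_pos.2 (norm_pos_iff.2 h))

theorem inner_cross_unitNormal (a b c d e f : E3) :
    inner ℝ (cross (unitNormal a b) (-unitNormal c d)) (cross (unitNormal a b) (unitNormal e f)) =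
      ‖cross a b‖⁻¹ ^ 2 * ‖cross c d‖⁻¹ * ‖cross e f‖⁻¹ *
        inner ℝ (cross (cross a b) (-cross c d)) (cross (cross a b) (cross e f)) := by
  simp only [unitNormal, inner_eq_sum, cross_coord, PiLp.smul_apply, PiLp.neg_apply, smul_eq_mul]
  ring

/-- All three normals are perpendicular to `z`, so both cross products are multiples of it.
Normalization contributes positive factors, except for a zero normal, and then `x * y` vanishes as
well. -/
theorem inner_cross_unitNormal_neg_iff {a b c d e f : E3} {x y : ℝ} {z : E3} (hz : z ≠ 0)
    (h₁ : cross (cross a b) (-cross c d) = x • z) (h₂ : cross (cross a b) (cross e f) = -y • z) :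
    inner ℝ (cross (unitNormal a b) (-unitNormal c d)) (cross (unitNormal a b) (unitNormal e f)) < 0 ↔
      0 < x * y := by
  rw [inner_cross_unitNormal]
  have hin : inner ℝ (cross (cross a b) (-cross c d)) (cross (cross a b) (cross e f)) =
      -(x * y) * ‖z‖ ^ 2 := by
    rw [h₁, h₂, inner_smul_left, inner_smul_right, real_inner_self_eq_norm_sq]
    simp only [conj_trivial]; ring
  have hz2 : 0 < ‖z‖ ^ 2 := by have := norm_pos_iff.2 hz; positivity
  rw [hin]
  constructor
  · intro h
    by_contra hc
    have hk : 0 ≤ ‖cross a b‖⁻¹ ^ 2 * ‖cross c d‖⁻¹ * ‖cross e f‖⁻¹ := by positivity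
    have := mul_nonneg hk (mul_nonneg (neg_nonneg.2 (not_lt.1 hc)) hz2.le)
    linarith
  · intro h
    -- The inverse norms are positive because a vanishing normal would make `x` or `y` zero.
    have hx : x ≠ 0 := by rintro rfl; simp at h
    have hy : y ≠ 0 := by rintro rfl; simp at h
    have ha : cross a b ≠ 0 := by
      intro h0
      rw [h0] at h₁
      have : cross 0 (-cross c d) = 0 := by simp [cross]
      rw [this] at h₁
      exact smul_ne_zero hx hz h₁.symm
    have hc : cross c d ≠ 0 := by
      intro h0
      have : cross (cross a b) (-0) = 0 := by simp [cross]
      rw [h0, this] at h₁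
      exact smul_ne_zero hx hz h₁.symm
    have he : cross e f ≠ 0 := by
      intro h0
      have : cross (cross a b) 0 = 0 := by simp [cross]
      rw [h0, this] at h₂
      exact smul_ne_zero (neg_ne_zero.2 hy) hz h₂.symm
    have ha' := norm_pos_iff.2 ha
    have hc' := norm_pos_iff.2 hc
    have he' := norm_pos_iff.2 he
    refine mul_neg_of_pos_of_neg (by positivity) (mul_neg_of_neg_of_pos (by linarith) hz2)

variable {p : Fin 5 → E3}

/-- The vectors `u₂`, `n₂`, `n₄` are normal to the planes through the edge `e₁` and `p 4`, `p 3`, `p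
2`, so the cross products are multiples of the vector along `e₁` with volumes as coefficients. -/
theorem wInv_neg_iff (hp : IsSimpleChain (n := 4) p) : wInv p < 0 ↔ 0 < vol₂ p * vol₃ p := by
  have hz : p 1 - p 0 ≠ 0 := fun h => hp.ne 0 (sub_eq_zero.1 h).symm
  have e1 : cross (p 0 - p 4) (p 1 - p 4) = cross (p 1 - p 0) (p 4 - p 0) := by
    apply E3.ext <;> simp [cross_coord] <;> ring
  have e2 : cross (p 0 - p 3) (p 1 - p 3) = cross (p 1 - p 0) (p 3 - p 0) := by
    apply E3.ext <;> simp [cross_coord] <;> ring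
  have e3 : cross (p 1 - p 2) (p 0 - p 2) = cross (p 1 - p 0) (p 0 - p 2) := by
    apply E3.ext <;> simp [cross_coord] <;> ring
  have e4 : -cross (p 1 - p 0) (p 3 - p 0) = cross (p 1 - p 0) (p 0 - p 3) := by
    apply E3.ext <;> simp [cross_coord] <;> ring
  refine inner_cross_unitNormal_neg_iff hz ?_ ?_
  · rw [e1, e2, e4, cross_cross_cross]
    congr 1
    simp only [vol₂, det3_eq, PiLp.sub_apply]; ring
  · rw [e1, e3, cross_cross_cross]
    congr 1
    simp only [vol₃, det3_eq, PiLp.sub_apply]; ring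

/-- The same argument for the planes through the edge `e₃` and `p 4`, `p 0`, `p 1`. -/
theorem w0Inv_neg_iff (hp : IsSimpleChain (n := 4) p) : w0Inv p < 0 ↔ 0 < vol₀ p * vol₁ p := by
  have hz : p 3 - p 2 ≠ 0 := fun h => hp.ne 2 (sub_eq_zero.1 h).symm
  have e1 : cross (p 2 - p 4) (p 2 - p 3) = cross (p 3 - p 2) (p 2 - p 4) := by
    apply E3.ext <;> simp [cross_coord] <;> ring
  have e2 : -cross (p 0 - p 2) (p 0 - p 3) = cross (p 3 - p 2) (p 2 - p 0) := by
    apply E3.ext <;> simp [cross_coord] <;> ring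
  have e3 : cross (p 1 - p 3) (p 1 - p 2) = cross (p 3 - p 2) (p 2 - p 1) := by
    apply E3.ext <;> simp [cross_coord] <;> ring
  rw [mul_comm]
  refine inner_cross_unitNormal_neg_iff hz ?_ ?_
  · rw [e1, e2, cross_cross_cross]
    congr 1
    simp only [vol₁, det3_eq, PiLp.sub_apply]; ring
  · rw [e1, e3, cross_cross_cross]
    congr 1
    simp only [vol₀, det3_eq, PiLp.sub_apply]; ring

theorem isPiercing_iff (hp : IsSimpleChain (n := 4) p) :
    IsPiercing p ↔ eps13 p = eps14 p ∧ wInv p < 0 ∧ w0Inv p < 0 := by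
  rw [wInv_neg_iff hp, w0Inv_neg_iff hp, eps13_eq, eps14_eq, IsPiercing]
  refine and_congr_left fun h => ?_
  have h2 : vol₂ p ≠ 0 := by intro h0; rw [h0] at h; simp at h
  rcases lt_or_gt_of_ne h2 with h2 | h2
  · rw [sign_neg h2, sign_eq_neg_one_iff, mul_pos_iff_neg_of_neg h2]
  · rw [sign_pos h2, sign_eq_one_iff, mul_pos_iff_of_pos_left h2]

theorem c41_eq : c41 p = ‖cross (p 0 - p 2) (p 0 - p 3)‖⁻¹ * (vol₄ p + vol₁ p) *
    ((SignType.sign (vol₄ p) : SignType) : ℝ) := by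
  rw [c41, eps13_eq, vn₁, quadNormal₁, real_inner_comm, inner_unitNormal]
  congr 2
  simp only [vol₄, vol₁, inner_eq_sum, cross_coord, det3_eq, PiLp.sub_apply]; ring

theorem IsPiercing.mul_nonpos_of_c41 (h : IsPiercing p) (hc : c41 p ≤ 0) :
    (vol₄ p + vol₁ p) * vol₄ p ≤ 0 := by
  -- If the normal `n₁` were zero, the triangle `p₀p₂p₃` would be degenerate and `vol₁` would
  -- vanish, against the piercing.
  have hn : cross (p 0 - p 2) (p 0 - p 3) ≠ 0 := by
    intro h0
    have : vol₁ p = det3 (p 0 - p 2) (p 0 - p 3) (p 0 - p 4) := by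
      simp only [vol₁, det3_eq, PiLp.sub_apply]; ring
    rw [det3, h0, inner_zero_left] at this
    have h01 := h.2.2
    rw [this] at h01
    simp at h01
  have hk := inv_pos.2 (norm_pos_iff.2 hn)
  rw [c41_eq, mul_assoc] at hc
  have hc' : (vol₄ p + vol₁ p) * ((SignType.sign (vol₄ p) : SignType) : ℝ) ≤ 0 := by
    by_contra hcon
    have := mul_pos hk (not_le.1 hcon)
    linarith
  rcases lt_trichotomy (vol₄ p) 0 with h4 | h4 | h4
  · rw [sign_neg h4] at hc'
    simp only [SignType.coe_neg_one, mul_neg, mul_one] at hc'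
    exact mul_nonpos_of_nonneg_of_nonpos (by linarith) h4.le
  · rw [h4, mul_zero]
  · rw [sign_pos h4] at hc'
    simp only [SignType.coe_one, mul_one] at hc'
    exact mul_nonpos_of_nonpos_of_nonneg hc' h4.le

end Formula

/-! ### Polygon areas and probabilities -/

section Main

open MeasureTheory

variable {p : Fin 5 → E3}

theorem inner_vv₃_pos_iff (ξ : E3) : 0 < (inner ℝ (vv₃ p) ξ : ℝ) ↔ 0 < -vbr p ξ 2 3 4 := by
  rw [vv₃, quadNormal₃, inner_unitNormal_pos_iff]
  refine iff_of_eq (congrArg _ ?_)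
  simp only [vbr, bracket, det3_eq, inner_eq_sum, cross_coord, PiLp.sub_apply]; ring

theorem inner_neg_vv₂_pos_iff (ξ : E3) : 0 < (inner ℝ (-vv₂ p) ξ : ℝ) ↔ vbr p ξ 1 2 4 < 0 := by
  have : -vv₂ p = unitNormal (p 2 - p 4) (p 1 - p 4) := by
    have h : cross (p 2 - p 4) (p 1 - p 4) = -cross (p 1 - p 4) (p 2 - p 4) := by
      apply E3.ext <;> simp [cross_coord] <;> ring
    rw [vv₂, quadNormal₂, unitNormal, unitNormal, h, norm_neg, smul_neg]
  rw [this, inner_unitNormal_pos_iff, ← neg_pos]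
  refine iff_of_eq (congrArg _ ?_)
  simp only [vbr, bracket, det3_eq, inner_eq_sum, cross_coord, PiLp.sub_apply]; ring

theorem inner_neg_vu₂_pos_iff (ξ : E3) : 0 < (inner ℝ (-vu₂ p) ξ : ℝ) ↔ vbr p ξ 0 1 4 < 0 := by
  have : -vu₂ p = unitNormal (p 1 - p 4) (p 0 - p 4) := by
    have h : cross (p 1 - p 4) (p 0 - p 4) = -cross (p 0 - p 4) (p 1 - p 4) := by
      apply E3.ext <;> simp [cross_coord] <;> ring
    rw [vu₂, quadNormal₂, unitNormal, unitNormal, h, norm_neg, smul_neg]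
  rw [this, inner_unitNormal_pos_iff, ← neg_pos]
  refine iff_of_eq (congrArg _ ?_)
  simp only [vbr, bracket, det3_eq, inner_eq_sum, cross_coord, PiLp.sub_apply]; ring

theorem inner_vn₁_pos_iff (ξ : E3) : 0 < (inner ℝ (vn₁ p) ξ : ℝ) ↔ 0 < vbr p ξ 0 2 3 := by
  rw [vn₁, quadNormal₁, inner_unitNormal_pos_iff]
  refine iff_of_eq (congrArg _ ?_)
  simp only [vbr, bracket, det3_eq, inner_eq_sum, cross_coord, PiLp.sub_apply]; ring

theorem polygonArea_four :
    polygonArea [vv₃ p, -vv₂ p, vn₁ p, -vu₂ p] = sphereMeasure.real (directions (InRegion p)) := by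
  rw [polygonArea, directions]
  congr 1
  ext ξ
  simp only [Set.mem_ofPred_eq, List.forall_mem_cons, List.not_mem_nil, false_imp_iff,
    implies_true, and_true, inner_vv₃_pos_iff, inner_neg_vv₂_pos_iff, inner_vn₁_pos_iff,
    inner_neg_vu₂_pos_iff, InRegion]
  tauto

theorem IsPiercing.vbr_pos (h : IsPiercing p) (hc : (vol₄ p + vol₁ p) * vol₄ p ≤ 0) {ξ : E3}
    (hu2 : vbr p ξ 0 1 4 < 0) (hv2 : vbr p ξ 1 2 4 < 0) (hv3 : 0 < -vbr p ξ 2 3 4) :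
    0 < vbr p ξ 0 2 3 := by
  obtain ⟨h24, h23, h01⟩ := h
  have hrel := bracketRel p ξ
  have hsum := vol_sum p
  rcases pos_and_pos_or_neg_and_neg_of_mul_pos h24 with ⟨h2, h4⟩ | ⟨h2, h4⟩
  · have h3 := pos_of_mul_pos_right h23 h2.le
    rcases pos_and_pos_or_neg_and_neg_of_mul_pos h01 with ⟨h0, h1⟩ | ⟨h0, h1⟩
    · linarith
    · exact hrel.n₁_pos_of_triangle h0 h1 h2 h3 (by nlinarith) hu2 hv2 hv3
  · have h3 := (mul_pos_iff_neg_of_neg h2).1 h23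
    rcases pos_and_pos_or_neg_and_neg_of_mul_pos h01 with ⟨h0, h1⟩ | ⟨h0, h1⟩
    · exact hrel.neg_coeff.n₁_pos_of_triangle (neg_lt_zero.2 h0) (neg_lt_zero.2 h1) (neg_pos.2 h2)
        (neg_pos.2 h3) (by nlinarith) hu2 hv2 hv3
    · linarith

theorem polygonArea_three (h : IsPiercing p) (hc : c41 p ≤ 0) :
    polygonArea [vv₃ p, -vv₂ p, -vu₂ p] = sphereMeasure.real (directions (InRegion p)) := by
  rw [polygonArea, directions]
  congr 1
  ext ξ
  simp only [Set.mem_ofPred_eq, List.forall_mem_cons, List.not_mem_nil, false_imp_iff,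
    implies_true, and_true, inner_vv₃_pos_iff, inner_neg_vv₂_pos_iff, inner_neg_vu₂_pos_iff,
    InRegion]
  have := h.vbr_pos (h.mul_nonpos_of_c41 hc) (ξ := ξ)
  tauto

theorem measurableSet_inRegion : MeasurableSet (directions (InRegion p)) := by
  have hc : ∀ i j k, Continuous fun ξ : Metric.sphere (0 : E3) 1 => vbr p (ξ : E3) i j k :=
    fun i j k => continuous_const.inner continuous_subtype_val
  exact ((isOpen_lt continuous_const (hc 0 2 3)).inter ((isOpen_lt (hc 0 1 4) continuous_const).inter
    ((isOpen_lt (hc 1 2 4) continuous_const).inter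
      (isOpen_lt continuous_const (hc 2 3 4).neg)))).measurableSet

theorem measurableSet_inRegion_neg :
    MeasurableSet (directions fun ξ => InRegion p (-ξ)) :=
  continuous_neg.measurable measurableSet_inRegion

theorem directions_isDiagramBi_ae_eq (hp : IsSimpleChain (n := 4) p) :
    directions (IsDiagramBi p) =ᵐ[sphereMeasure]
      directions fun ξ => IsPiercing p ∧ (InRegion p ξ ∨ InRegion p (-ξ)) := by
  filter_upwards [ae_isRegularDirection p] with ξ hξ
  exact propext (isDiagramBi_iff hp hξ)

theorem nullMeasurableSet_isDiagramBi (hp : IsSimpleChain (n := 4) p) :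
    NullMeasurableSet (directions (IsDiagramBi p)) sphereMeasure := by
  refine NullMeasurableSet.congr ?_ (directions_isDiagramBi_ae_eq hp).symm
  by_cases h : IsPiercing p
  · simp only [h, true_and]
    exact (measurableSet_inRegion.union measurableSet_inRegion_neg).nullMeasurableSet
  · simp only [h, false_and]
    exact MeasurableSet.empty.nullMeasurableSet

theorem dirProb_isDiagramBi_of_not_isPiercing (hp : IsSimpleChain (n := 4) p)
    (h : ¬IsPiercing p) : dirProb (IsDiagramBi p) = 0 := by
  rw [dirProb, measureReal_congr (directions_isDiagramBi_ae_eq hp)]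
  simp [h, directions]

/-- The polygon and its antipode are disjoint, since `n₁` has opposite signs on them, and have equal
areas; the probability is twice the area over `4π`. -/
theorem dirProb_isDiagramBi_of_isPiercing (hp : IsSimpleChain (n := 4) p)
    (h : IsPiercing p) : dirProb (IsDiagramBi p) =
      1 / (2 * Real.pi) * sphereMeasure.real (directions (InRegion p)) := by
  have hdisj : Disjoint (directions (InRegion p)) (directions fun ξ => InRegion p (-ξ)) := by
    rw [Set.disjoint_left]
    intro ξ h1 h2
    exact lt_asymm h1.1 (inRegion_neg.1 h2).1
  have hset : (directions fun ξ => IsPiercing p ∧ (InRegion p ξ ∨ InRegion p (-ξ))) =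
      directions (InRegion p) ∪ directions fun ξ => InRegion p (-ξ) := by
    simp only [h, true_and]; rfl
  have hneg : sphereMeasure.real (directions fun ξ => InRegion p (-ξ)) =
      sphereMeasure.real (directions (InRegion p)) :=
    congrArg ENNReal.toReal (sphereMeasure_neg measurableSet_inRegion)
  rw [dirProb, measureReal_congr (directions_isDiagramBi_ae_eq hp), hset,
    measureReal_union hdisj measurableSet_inRegion_neg, hneg, sphereMeasure_real_univ]
  have := Real.pi_pos
  field_simp
  ring

theorem directions_isDiagramBii :
    directions (IsDiagramBii p) = directions (IsDiagramBi (reverseChain (n := 4) p)) := by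
  ext ξ; exact isDiagramBii_iff_reverse

theorem nullMeasurableSet_isDiagramBii (hp : IsSimpleChain (n := 4) p) :
    NullMeasurableSet (directions (IsDiagramBii p)) sphereMeasure := by
  rw [directions_isDiagramBii]
  exact nullMeasurableSet_isDiagramBi hp.reverse

theorem directions_projectsToK21_ae_eq (hp : IsSimpleChain (n := 4) p) :
    directions (ProjectsToK21 (n := 4) p) =ᵐ[sphereMeasure]
      (directions (IsDiagramBi p) ∪ directions (IsDiagramBii p) : Set _) := by
  filter_upwards [ae_isRegularDirection p] with ξ hξ
  exact propext (projectsToK21_iff hp hξ)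

theorem dirProb_projectsToK21 (hp : IsSimpleChain (n := 4) p) :
    dirProb (ProjectsToK21 (n := 4) p) = dirProb (IsDiagramBi p) + dirProb (IsDiagramBii p) := by
  have hdisj : Disjoint (directions (IsDiagramBi p)) (directions (IsDiagramBii p)) := by
    rw [Set.disjoint_left]
    rintro ξ ⟨-, ⟨s, t, _, _, h, -⟩, -⟩ h2
    -- A diagram B(i) has a crossing of `e₁` with `e₃`, which B(ii) excludes.
    exact h2.2.2 ⟨s, t, h⟩
  rw [dirProb, dirProb, dirProb, measureReal_congr (directions_projectsToK21_ae_eq hp),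
    measureReal_union₀ (nullMeasurableSet_isDiagramBii hp) hdisj.aedisjoint, add_div]

end Main

theorem mainTheorem6 (p : Fin 5 → E3) (hp : IsSimpleChain (n := 4) p) :
    -- the probabilities are areas of measurable sets
    (MeasureTheory.NullMeasurableSet (directions (ProjectsToK21 (n := 4) p)) sphereMeasure ∧
      MeasureTheory.NullMeasurableSet (directions (IsDiagramBi p)) sphereMeasure ∧
      MeasureTheory.NullMeasurableSet (directions (IsDiagramBii p)) sphereMeasure) ∧
    -- the two kinds of diagrams
    dirProb (ProjectsToK21 (n := 4) p) = dirProb (IsDiagramBi p) + dirProb (IsDiagramBii p) ∧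
    -- the diagrams of the first kind
    (¬ (eps13 p = eps14 p ∧ wInv p < 0 ∧ w0Inv p < 0) → dirProb (IsDiagramBi p) = 0) ∧
    (eps13 p = eps14 p → wInv p < 0 → w0Inv p < 0 → c41 p ≤ 0 →
      dirProb (IsDiagramBi p) =
        1 / (2 * Real.pi) * polygonArea [vv₃ p, -vv₂ p, -vu₂ p]) ∧
    (eps13 p = eps14 p → wInv p < 0 → w0Inv p < 0 → 0 ≤ c41 p →
      dirProb (IsDiagramBi p) =
        1 / (2 * Real.pi) * polygonArea [vv₃ p, -vv₂ p, vn₁ p, -vu₂ p]) ∧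
    -- the diagrams of the second kind
    dirProb (IsDiagramBii p) = dirProb (IsDiagramBi (reverseChain (n := 4) p)) := by
  refine ⟨⟨?_, nullMeasurableSet_isDiagramBi hp, nullMeasurableSet_isDiagramBii hp⟩,
    dirProb_projectsToK21 hp, fun h => ?_, fun h1 h2 h3 hc => ?_, fun h1 h2 h3 _ => ?_, ?_⟩
  · exact ((nullMeasurableSet_isDiagramBi hp).union (nullMeasurableSet_isDiagramBii hp)).congr
      (directions_projectsToK21_ae_eq hp).symm
  · exact dirProb_isDiagramBi_of_not_isPiercing hp fun h' => h ((isPiercing_iff hp).1 h')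
  · have h := (isPiercing_iff hp).2 ⟨h1, h2, h3⟩
    rw [polygonArea_three h hc]
    exact dirProb_isDiagramBi_of_isPiercing hp h
  · rw [polygonArea_four]
    exact dirProb_isDiagramBi_of_isPiercing hp ((isPiercing_iff hp).2 ⟨h1, h2, h3⟩)
  · rw [dirProb, dirProb, directions_isDiagramBii]
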